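/- **Setting.** Consider a Markov decision process with finite state space $\mathcal S$, finite action space, transition probabilities $P(s'\mid s,a)$, rewards $r(s,a)\in[0,1]$ and discount factor $\gamma\in[0,1)$, and a policy $\pi$ whose induced transition matrix $P(s'\mid s)=\sum_a\pi(a\mid s)P(s'\mid s,a)$ has a unique stationary distribution $\mu$. Let $\phi:\mathcal S\to\mathbb R^d$ satisfy $\|\phi(s)\|_2\le 1$ for all $s$. For $s\sim\mu$, $a\sim\pi(\cdot\mid s)$, $s'\sim P(\cdot\mid s,a)$ put $$\Sigma=\mathbb E[\phi(s)\phi(s)^\top],\quad \lambda_0=\lambda_{\min}(\Sigma),\quad A=\mathbb E[\phi(s)(\phi(s)-\gamma\phi(s'))^\top],\quad b=\mathbb E[r(s,a)\phi(s)],\quad \theta^\star=A^{-1}b,$$ $$\Gamma=\mathbb E[gg^\top]\ \text{ with }\ g=\phi(s)(\phi(s)-\gamma\phi(s'))^\top\theta^\star-r(s,a)\phi(s),\qquad \Lambda^\star=A^{-1}\Gamma A^{-\top},$$ and assume that $\lambda_0>0$ and that $\Gamma$ is positive definite, with condition number $\mathrm{cond}(\Gamma)=\lambda_{\max}(\Gamma)/\lambda_{\min}(\Gamma)$.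 For stepsizes $\eta_t=\eta_0t^{-\alpha}$ with $\alpha\in(\tfrac12,1)$ and $0<\eta_0<\tfrac12$, and for $T\ge1$, put $$\bar\Lambda_T=\frac1T\sum_{t=1}^TQ_t\Gamma Q_t^\top,\qquad Q_t=\eta_t\sum_{j=t}^T\ \prod_{k=t+1}^j(I-\eta_kA).$$ For probability measures $P,Q$ on $\mathbb R^d$ let $d_{\mathsf{TV}}(P,Q)$ and $d_{\mathsf C}(P,Q)$ be the supremum of $|P(B)-Q(B)|$ over all Borel sets $B$ and over all convex sets $B$, respectively. **Theorem.** There is a function $C:\mathbb R\to(0,\infty)$ such that for every setting as above there is a constant $\tilde C'$ independent of $T$ (it may depend on everything else) with, for all integers $T\ge1$, $$d_{\mathsf C}\big(\mathcal N(0,\bar\Lambda_T),\mathcal N(0,\Lambda^\star)\big)\le d_{\mathsf{TV}}\big(\mathcal N(0,\bar\Lambda_T),\mathcal N(0,\Lambda^\star)\big)\le C\big(\mathrm{cond}(\Gamma)\big)\,\frac{\sqrt{d\,\mathrm{cond}(\Gamma)}}{(1-\gamma)\lambda_0\eta_0}\,T^{\alpha-1}+\tilde C'\,T^{2\alpha-2}.$$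 That is, the multiplicative constant in front of the leading term depends on nothing but $\mathrm{cond}(\Gamma)$. -/

import Mathlib

open MeasureTheory ProbabilityTheory

noncomputable section

/-- A discounted Markov decision process with finite state space `S` and finite action space `Act`:
transition probabilities `P s a s'`, rewards in `[0, 1]` and a discount factor in `[0, 1)`. -/
structure MDP (S Act : Type*) [Fintype S] [Fintype Act] where
  P : S → Act → S → ℝ
  P_mem : ∀ s a, P s a ∈ stdSimplex ℝ S
  r : S → Act → ℝ
  r_mem : ∀ s a, r s a ∈ Set.Icc (0 : ℝ) 1
  γ : ℝ
  γ_nonneg : 0 ≤ γ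
  γ_lt_one : γ < 1

/-- `π s a` is the probability that the policy selects `a` in the state `s`. -/
def IsPolicy {S Act : Type*} [Fintype Act] (π : S → Act → ℝ) : Prop :=
  ∀ s, π s ∈ stdSimplex ℝ Act

namespace MDP

variable {S Act : Type*} [Fintype S] [Fintype Act] {d : ℕ}

/-- The transition matrix on states induced by the policy `π`. -/
def kernel (M : MDP S Act) (π : S → Act → ℝ) (s s' : S) : ℝ :=
  ∑ a, π s a * M.P s a s'

/-- The expected reward `r(s)` under the policy `π`. -/
def reward (M : MDP S Act) (π : S → Act → ℝ) (s : S) : ℝ :=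
  ∑ a, π s a * M.r s a

/-- `μ` is a stationary distribution of the transition matrix induced by `π`. -/
def IsStationary (M : MDP S Act) (π : S → Act → ℝ) (μ : S → ℝ) : Prop :=
  μ ∈ stdSimplex ℝ S ∧ ∀ s', ∑ s, μ s * M.kernel π s s' = μ s'

/-- `μ` is the unique stationary distribution of the transition matrix induced by `π`. -/
def IsUniqueStationary (M : MDP S Act) (π : S → Act → ℝ) (μ : S → ℝ) : Prop :=
  M.IsStationary π μ ∧ ∀ ν, M.IsStationary π ν → ν = μ

/-- The random matrix `φ(s) (φ(s) - γ φ(s'))ᵀ` of a sampled transition from `s` to `s'`. -/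
def sampleA (M : MDP S Act) (φ : S → EuclideanSpace ℝ (Fin d)) (s s' : S) :
    Matrix (Fin d) (Fin d) ℝ :=
  Matrix.vecMulVec (φ s).ofLp (φ s - M.γ • φ s').ofLp

/-- The random vector `r(s, a) φ(s)` of a sampled state-action pair. -/
def sampleB (M : MDP S Act) (φ : S → EuclideanSpace ℝ (Fin d)) (s : S) (a : Act) : Fin d → ℝ :=
  M.r s a • (φ s).ofLp

/-- `A = 𝔼[φ(s) (φ(s) - γ φ(s'))ᵀ]` for `s ∼ μ`, `s' ∼ P(· ∣ s)`. -/
def meanA (M : MDP S Act) (π : S → Act → ℝ) (μ : S → ℝ) (φ : S → EuclideanSpace ℝ (Fin d)) :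
    Matrix (Fin d) (Fin d) ℝ :=
  ∑ s, ∑ s', (μ s * M.kernel π s s') • M.sampleA φ s s'

/-- `b = 𝔼[φ(s) r(s)]` for `s ∼ μ`. -/
def meanB (M : MDP S Act) (π : S → Act → ℝ) (μ : S → ℝ) (φ : S → EuclideanSpace ℝ (Fin d)) :
    Fin d → ℝ :=
  ∑ s, (μ s * M.reward π s) • (φ s).ofLp

/-- `θ⋆ = A⁻¹ b`. -/
def thetaStar (M : MDP S Act) (π : S → Act → ℝ) (μ : S → ℝ) (φ : S → EuclideanSpace ℝ (Fin d)) :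
    Fin d → ℝ :=
  (M.meanA π μ φ)⁻¹.mulVec (M.meanB π μ φ)

/-- `Γ = 𝔼[(A_t θ⋆ - b_t) (A_t θ⋆ - b_t)ᵀ]`, the expectation being over a sampled tuple
`s ∼ μ`, `a ∼ π(s)`, `s' ∼ P(· ∣ s, a)`. -/
def noiseCov (M : MDP S Act) (π : S → Act → ℝ) (μ : S → ℝ) (φ : S → EuclideanSpace ℝ (Fin d)) :
    Matrix (Fin d) (Fin d) ℝ :=
  ∑ s, ∑ a, ∑ s', (μ s * π s a * M.P s a s') •
    Matrix.vecMulVec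
      ((M.sampleA φ s s').mulVec (M.thetaStar π μ φ) - M.sampleB φ s a)
      ((M.sampleA φ s s').mulVec (M.thetaStar π μ φ) - M.sampleB φ s a)

/-- `Λ⋆ = A⁻¹ Γ A⁻ᵀ`. -/
def lambdaStar (M : MDP S Act) (π : S → Act → ℝ) (μ : S → ℝ) (φ : S → EuclideanSpace ℝ (Fin d)) :
    Matrix (Fin d) (Fin d) ℝ :=
  (M.meanA π μ φ)⁻¹ * M.noiseCov π μ φ * ((M.meanA π μ φ)⁻¹).transpose

end MDP

/-- The feature covariance matrix `Σ = 𝔼[φ(s) φ(s)ᵀ]` for `s ∼ μ`. -/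
def featureCov {S : Type*} [Fintype S] {d : ℕ} (μ : S → ℝ) (φ : S → EuclideanSpace ℝ (Fin d)) :
    Matrix (Fin d) (Fin d) ℝ :=
  ∑ s, μ s • Matrix.vecMulVec (φ s).ofLp (φ s).ofLp

/-- Smallest eigenvalue of a real symmetric matrix. -/
def lambdaMin {d : ℕ} (M : Matrix (Fin d) (Fin d) ℝ) : ℝ := sInf (spectrum ℝ M)

/-- Largest eigenvalue of a real symmetric matrix. -/
def lambdaMax {d : ℕ} (M : Matrix (Fin d) (Fin d) ℝ) : ℝ := sSup (spectrum ℝ M)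

/-- Condition number of a real symmetric positive definite matrix. -/
def condNumber {d : ℕ} (M : Matrix (Fin d) (Fin d) ℝ) : ℝ := lambdaMax M / lambdaMin M

/-- The stepsize `η_t = η₀ t^{-α}`. -/
def stepsize (η₀ α : ℝ) (t : ℕ) : ℝ := η₀ * (t : ℝ) ^ (-α)

/-- `∏_{k=t+1}^{j} (I - η_k A)`. The factors commute; the product is `1` when `j = t`. -/
def stepProd {d : ℕ} (A : Matrix (Fin d) (Fin d) ℝ) (η₀ α : ℝ) (t j : ℕ) :
    Matrix (Fin d) (Fin d) ℝ :=
  ((List.Ico (t + 1) (j + 1)).map fun k => 1 - stepsize η₀ α k • A).prod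

/-- `Q_t = η_t ∑_{j=t}^{T} ∏_{k=t+1}^{j} (I - η_k A)`. -/
def matQ {d : ℕ} (A : Matrix (Fin d) (Fin d) ℝ) (η₀ α : ℝ) (T t : ℕ) :
    Matrix (Fin d) (Fin d) ℝ :=
  stepsize η₀ α t • ∑ j ∈ Finset.Icc t T, stepProd A η₀ α t j

/-- `Λ̄_T = T⁻¹ ∑_{t=1}^{T} Q_t Γ Q_tᵀ`. -/
def lambdaBar {d : ℕ} (A Γ : Matrix (Fin d) (Fin d) ℝ) (η₀ α : ℝ) (T : ℕ) :
    Matrix (Fin d) (Fin d) ℝ :=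
  (T : ℝ)⁻¹ • ∑ t ∈ Finset.Icc 1 T, matQ A η₀ α T t * Γ * (matQ A η₀ α T t).transpose

/-- The centered Gaussian law `𝒩(0, Λ)` on `ℝᵈ`. -/
def centeredGaussian {d : ℕ} (Λ : Matrix (Fin d) (Fin d) ℝ) :
    Measure (EuclideanSpace ℝ (Fin d)) :=
  multivariateGaussian 0 Λ

/-- Total variation distance: supremum of `|P(B) - Q(B)|` over measurable `B`. -/
def tvDistance {d : ℕ} (P Q : Measure (EuclideanSpace ℝ (Fin d))) : ℝ :=
  ⨆ B : {B : Set (EuclideanSpace ℝ (Fin d)) // MeasurableSet B}, |P.real B.1 - Q.real B.1|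

/-- Convex distance: supremum of `|P(B) - Q(B)|` over all convex `B`. -/
def convexDistance {d : ℕ} (P Q : Measure (EuclideanSpace ℝ (Fin d))) : ℝ :=
  ⨆ B : {B : Set (EuclideanSpace ℝ (Fin d)) // Convex ℝ B}, |P.real B.1 - Q.real B.1|

end

/-! Write `Q_t = A⁻¹(I + E_t)` and `w = A⁻ᵀv`. The covariance forms of `Λ̄_T` and `Λ⋆` at `v` then
differ by the average over `t` of a part linear in `E_t`, namely `2 (E_tᵀw)ᵀΓw`, and a quadratic
part `(E_tᵀw)ᵀΓ(E_tᵀw)`. The errors telescope (`sum_stepError`) to a matrix bounded in `T`, so the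
linear part is only `O(1/T)`, and the mean square of `E_t` decides the rate.

Up to sign, `E_t` is the product of the `I - η_k A` over `t < k ≤ T + 1`, plus a drift of size
`O(t^(α-1))` (`norm_stepDrift_le`) whose squares sum to `O(T^(2α-1))`. With `c = (1-γ)λ₀`, the
coercivity `featureCov_le_meanA` makes squared norms eventually contract by `1 - cη_k`, so the
squared products sum to at most `1/(cη_{T+1})`, of order `T^α/(cη₀)` (`sum_norm_stepProd_sq_le`).
The forms thus have relative error `ε = 4 cond(Γ)/(cη₀) T^(α-1) + O(T^(2α-2))`.

For the Gaussian laws, simultaneous diagonalization reduces to comparing product Gaussians with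
variances within `ε` of `1` to the standard one. Chi-square divergence factorizes over coordinates,
which gives `√(2d) ε` (`tvDistance_centeredGaussian_le`). Convex sets need not be Borel, but their
frontiers are null for nondegenerate Gaussians (`convexDistance_le_tvDistance`). -/

/-! ### Chi-square bound for product Gaussians -/

/-- A finite product of measures with nonnegative integrable densities has the product density. -/
theorem pi_withDensity_ofReal {ι : Type*} [Fintype ι] {X : ι → Type*}
    [∀ i, MeasurableSpace (X i)] (Q : ∀ i, Measure (X i)) [∀ i, SigmaFinite (Q i)]
    {f : ∀ i, X i → ℝ} (hf : ∀ i x, 0 ≤ f i x) (hfi : ∀ i, Integrable (f i) (Q i)) :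
    Measure.pi (fun i => (Q i).withDensity fun x => ENNReal.ofReal (f i x)) =
      (Measure.pi Q).withDensity fun x => ENNReal.ofReal (∏ i, f i (x i)) := by
  have hfin : ∀ i, IsFiniteMeasure ((Q i).withDensity fun x => ENNReal.ofReal (f i x)) :=
    fun i => isFiniteMeasure_withDensity_ofReal (hfi i).2
  refine Measure.pi_eq (μ := fun i => (Q i).withDensity fun x => ENNReal.ofReal (f i x))
    fun s hs => ?_
  rw [withDensity_apply _ (MeasurableSet.univ_pi hs), ← ofReal_integral_eq_lintegral_ofReal,
    Measure.restrict_pi_pi, integral_fintype_prod_eq_prod, ENNReal.ofReal_prod_of_nonneg]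
  · refine Finset.prod_congr rfl fun i _ => ?_
    rw [withDensity_apply _ (hs i), ← ofReal_integral_eq_lintegral_ofReal (hfi i).restrict
      (Filter.Eventually.of_forall (hf i))]
  · exact fun i _ => integral_nonneg (hf i)
  · exact (Integrable.fintype_prod_dep hfi).restrict
  · exact Filter.Eventually.of_forall fun x => Finset.prod_nonneg fun i _ => hf i _

/-- Two integrable densities whose chi-square divergence is `X` assign to every measurable set
probabilities that differ by at most `√X`. -/
theorem abs_integral_sub_le_sqrt_chiSq {Ω : Type*} [MeasurableSpace Ω] {μ : Measure Ω}
    {p q : Ω → ℝ} (hp : Integrable p μ) (hq : Integrable q μ)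
    (hpq : Integrable (fun x => p x ^ 2 / q x) μ) (hq0 : ∀ x, 0 < q x)
    (hp1 : ∫ x, p x ∂μ = 1) (hq1 : ∫ x, q x ∂μ = 1) (B : Set Ω) :
    |∫ x in B, p x ∂μ - ∫ x in B, q x ∂μ| ≤ Real.sqrt (∫ x, p x ^ 2 / q x ∂μ - 1) := by
  set X := ∫ x, p x ^ 2 / q x ∂μ - 1
  set τ := |∫ x in B, p x ∂μ - ∫ x in B, q x ∂μ|
  have hτ : τ ≤ ∫ x, |p x - q x| ∂μ := by
    calc τ = |∫ x in B, (p x - q x) ∂μ| := by rw [integral_sub hp.integrableOn hq.integrableOn]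
      _ ≤ ∫ x in B, |p x - q x| ∂μ := abs_integral_le_integral_abs
      _ ≤ ∫ x, |p x - q x| ∂μ := setIntegral_le_integral (hp.sub hq).abs
          (Filter.Eventually.of_forall fun x => abs_nonneg _)
  -- Weighted AM-GM, `2|p - q| ≤ s (p - q)²/q + q/s`, integrated. The later choice `s = 1/τ` gives
  -- `τ² ≤ X` without separating the case `X = 0`.
  have key : ∀ s : ℝ, 0 < s → τ ≤ (s * X + s⁻¹) / 2 := by
    intro s hs
    have h1 : ∫ x, (s * (p x ^ 2 / q x - 2 * p x + q x) + s⁻¹ * q x) / 2 ∂μ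
        = (s * X + s⁻¹) / 2 := by
      rw [integral_div, integral_add, integral_const_mul, integral_const_mul, integral_add,
        integral_sub, integral_const_mul, hp1, hq1]
      · simp only [X]; ring
      · exact hpq
      · exact hp.const_mul 2
      · exact hpq.sub (hp.const_mul 2)
      · exact hq
      · exact ((hpq.sub (hp.const_mul 2)).add hq).const_mul s
      · exact hq.const_mul _
    rw [← h1]
    refine hτ.trans (integral_mono (hp.sub hq).abs ?_ fun x => ?_)
    · exact ((((hpq.sub (hp.const_mul 2)).add hq).const_mul s).add (hq.const_mul _)).div_const 2
    · have hx := hq0 x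
      have h2 : p x ^ 2 / q x - 2 * p x + q x = (p x - q x) ^ 2 / q x := by field_simp; ring
      simp only [h2]
      have h3 : (s * ((p x - q x) ^ 2 / q x) + s⁻¹ * q x) / 2 - |p x - q x|
          = (s * |p x - q x| - q x) ^ 2 / (2 * s * q x) := by
        rw [← sq_abs (p x - q x)]; field_simp; ring
      have : 0 ≤ (s * |p x - q x| - q x) ^ 2 / (2 * s * q x) := by positivity
      linarith
  have hτ0 : 0 ≤ τ := abs_nonneg _
  clear_value τ
  rcases hτ0.eq_or_lt with h0 | h0
  · rw [← h0]; exact Real.sqrt_nonneg _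
  · refine Real.le_sqrt_of_sq_le ?_
    have h := key τ⁻¹ (inv_pos.2 h0)
    rw [inv_inv] at h
    have h4 : τ ≤ τ⁻¹ * X := by linarith
    calc τ ^ 2 = τ * τ := by ring
      _ ≤ τ * (τ⁻¹ * X) := by gcongr
      _ = X := by field_simp

open Real in
theorem gaussianPDFReal_sq_div_gaussianPDFReal_one {v : NNReal} (hv : 0 < v) (x : ℝ) :
    gaussianPDFReal 0 v x ^ 2 / gaussianPDFReal 0 1 x =
      (√(2 * π) / (2 * π * v)) * rexp (-((v : ℝ)⁻¹ - 2⁻¹) * x ^ 2) := by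
  have hv' : (0 : ℝ) < v := hv
  simp only [gaussianPDFReal, NNReal.coe_one, mul_one, sub_zero, mul_pow, inv_pow]
  rw [Real.sq_sqrt (by positivity), ← Real.exp_nat_mul, mul_div_mul_comm, ← Real.exp_sub, div_inv_eq_mul]
  congr 1
  · field_simp
  · congr 1; push_cast; field_simp; ring

/-- The quotient is a multiple of `exp(-(1/v - 1/2) x²)`, which decays because `v < 2`. -/
theorem integrable_gaussianPDFReal_sq_div {v : NNReal} (hv : 0 < v) (hv2 : v < 2) :
    Integrable (fun x => gaussianPDFReal 0 v x ^ 2 / gaussianPDFReal 0 1 x) := by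
  simp only [gaussianPDFReal_sq_div_gaussianPDFReal_one hv]
  refine (integrable_exp_neg_mul_sq ?_).const_mul _
  have hv' : (0 : ℝ) < v := hv
  have hv2' : (v : ℝ) < 2 := hv2
  rw [sub_pos]
  exact inv_strictAnti₀ hv' hv2'

-- With `y = v - 1` the integral equals `(1 - y²)^(-1/2)`. The bound amounts to `1 ≤ (1 + y²)²(1 -
-- y²)`, that is, to `y²(1 - y² - y⁴) ≥ 0`.
open Real in
theorem integral_gaussianPDFReal_sq_div_le {v : NNReal} (hv : |(v : ℝ) - 1| ≤ 1 / 2) :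
    ∫ x, gaussianPDFReal 0 v x ^ 2 / gaussianPDFReal 0 1 x ≤ 1 + ((v : ℝ) - 1) ^ 2 := by
  obtain ⟨h1, h2⟩ := abs_le.1 hv
  have hv' : (0 : ℝ) < v := by linarith
  have hv2 : (0 : ℝ) < 2 - v := by linarith
  simp only [gaussianPDFReal_sq_div_gaussianPDFReal_one (NNReal.coe_pos.1 hv')]
  rw [integral_const_mul, integral_gaussian]
  have e : π / ((v : ℝ)⁻¹ - 2⁻¹) = (2 * π) * (v / (2 - v)) := by field_simp
  rw [e, Real.sqrt_mul (by positivity : 0 ≤ 2 * π), div_mul_eq_mul_div, ← mul_assoc,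
    Real.mul_self_sqrt (by positivity), mul_div_mul_left _ _ (by positivity),
    div_le_iff₀ hv']
  refine Real.sqrt_le_iff.2 ⟨by positivity, ?_⟩
  rw [div_le_iff₀ hv2]
  set y : ℝ := (v : ℝ) - 1 with hy
  have : (v : ℝ) = 1 + y := by rw [hy]; ring
  rw [this]
  have hy2 : y ^ 2 ≤ 1 / 4 := by nlinarith
  have h3 : 0 ≤ 1 + y := by linarith
  have h5 : 0 ≤ y ^ 2 * (1 - y ^ 2 - y ^ 4) := by
    refine mul_nonneg (sq_nonneg _) ?_
    nlinarith [sq_nonneg y]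
  nlinarith [mul_nonneg h3 h5]

theorem pi_gaussianReal_eq_withDensity {ι : Type*} [Fintype ι] {v : ι → NNReal}
    (hv : ∀ i, 0 < v i) :
    Measure.pi (fun i => gaussianReal 0 (v i)) =
      (volume : Measure (ι → ℝ)).withDensity
        fun x => ENNReal.ofReal (∏ i, gaussianPDFReal 0 (v i) (x i)) := by
  rw [volume_pi, ← pi_withDensity_ofReal (fun _ => volume)
    (fun i x => gaussianPDFReal_nonneg 0 (v i) x) fun i => integrable_gaussianPDFReal 0 (v i)]
  congr 1
  ext1 i
  exact gaussianReal_of_var_ne_zero 0 (hv i).ne'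

/-- The standard Gaussian density and a product of nearly standard Gaussian densities are close in
total variation. -/
theorem abs_pi_gaussianReal_sub_le {ι : Type*} [Fintype ι] {v : ι → NNReal} {ε : ℝ}
    (hv : ∀ i, |(v i : ℝ) - 1| ≤ ε) (hε : ε ≤ 1 / 2) (hdε : Fintype.card ι * ε ^ 2 ≤ 1)
    (hε0 : 0 ≤ ε) {B : Set (ι → ℝ)} (hB : MeasurableSet B) :
    |(Measure.pi fun i => gaussianReal 0 (v i)).real B -
      (Measure.pi fun _ : ι => gaussianReal 0 1).real B| ≤
      Real.sqrt (2 * Fintype.card ι) * ε := by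
  have hv1 : ∀ i, |(v i : ℝ) - 1| ≤ 1 / 2 := fun i => (hv i).trans hε
  have hv0 : ∀ i, 0 < v i := fun i => by
    have := (abs_le.1 (hv1 i)).1
    exact NNReal.coe_pos.1 (by linarith)
  have hv2 : ∀ i, v i < 2 := fun i => by
    have := (abs_le.1 (hv1 i)).2
    exact NNReal.coe_lt_coe.1 (by push_cast; linarith)
  have real_eq : ∀ w : ι → NNReal, (∀ i, 0 < w i) →
      (Measure.pi fun i => gaussianReal 0 (w i)).real B =
        ∫ x in B, ∏ i, gaussianPDFReal 0 (w i) (x i) := by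
    intro w hw
    rw [pi_gaussianReal_eq_withDensity hw, measureReal_def, withDensity_apply _ hB,
      integral_eq_lintegral_of_nonneg_ae]
    · exact Filter.Eventually.of_forall fun x =>
        Finset.prod_nonneg fun i _ => gaussianPDFReal_nonneg _ _ _
    · exact (Integrable.fintype_prod fun i =>
        integrable_gaussianPDFReal 0 (w i)).aestronglyMeasurable.restrict
  have e : ∀ x : ι → ℝ, (∏ i, gaussianPDFReal 0 (v i) (x i)) ^ 2 / ∏ i, gaussianPDFReal 0 1 (x i) =
      ∏ i, gaussianPDFReal 0 (v i) (x i) ^ 2 / gaussianPDFReal 0 1 (x i) := fun x => by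
    rw [← Finset.prod_pow, Finset.prod_div_distrib]
  rw [real_eq v hv0, real_eq (fun _ => 1) fun _ => one_pos]
  refine (abs_integral_sub_le_sqrt_chiSq ?_ ?_ ?_ ?_ ?_ ?_ B).trans ?_
  · exact Integrable.fintype_prod fun i => integrable_gaussianPDFReal 0 (v i)
  · exact Integrable.fintype_prod fun i => integrable_gaussianPDFReal 0 1
  · simp only [e]
    exact Integrable.fintype_prod fun i => integrable_gaussianPDFReal_sq_div (hv0 i) (hv2 i)
  · exact fun x => Finset.prod_pos fun i _ => gaussianPDFReal_pos _ _ _ one_ne_zero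
  · rw [integral_fintype_prod_volume_eq_prod]
    exact Finset.prod_eq_one fun i _ => integral_gaussianPDFReal_eq_one 0 (hv0 i).ne'
  · rw [integral_fintype_prod_volume_eq_prod (f := fun _ : ι => gaussianPDFReal 0 1)]
    exact Finset.prod_eq_one fun i _ => integral_gaussianPDFReal_eq_one 0 one_ne_zero
  · simp only [e]
    rw [integral_fintype_prod_volume_eq_prod
      (f := fun i x => gaussianPDFReal 0 (v i) x ^ 2 / gaussianPDFReal 0 1 x)]
    -- The chain is `1 + χ² ≤ (1 + ε²)^d ≤ exp(dε²) ≤ 1 + 2dε²`; the last inequality needs `dε² ≤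
    -- 1`.
    have h1 : ∏ i, ∫ x, gaussianPDFReal 0 (v i) x ^ 2 / gaussianPDFReal 0 1 x ≤
        ∏ _i : ι, (1 + ε ^ 2) := by
      refine Finset.prod_le_prod (fun i _ => integral_nonneg fun x => ?_) fun i _ => ?_
      · exact div_nonneg (sq_nonneg _) (gaussianPDFReal_nonneg _ _ _)
      · refine (integral_gaussianPDFReal_sq_div_le (hv1 i)).trans ?_
        rw [← sq_abs]
        gcongr
        exact hv i
    rw [Finset.prod_const, Finset.card_univ] at h1
    have h2 : (1 + ε ^ 2) ^ Fintype.card ι ≤ Real.exp (Fintype.card ι * ε ^ 2) := by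
      rw [Real.exp_nat_mul]
      gcongr
      rw [add_comm]
      exact Real.add_one_le_exp _
    have h3 : Real.exp (Fintype.card ι * ε ^ 2) ≤ 1 + 2 * (Fintype.card ι * ε ^ 2) := by
      have hy : 0 ≤ Fintype.card ι * ε ^ 2 := by positivity
      have := Real.abs_exp_sub_one_le (x := Fintype.card ι * ε ^ 2) (by rwa [abs_of_nonneg hy])
      rw [abs_of_nonneg hy] at this
      linarith [le_abs_self (Real.exp (Fintype.card ι * ε ^ 2) - 1)]
    rw [← Real.sqrt_sq hε0, ← Real.sqrt_mul (by positivity)]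
    refine Real.sqrt_le_sqrt ?_
    linarith

/-! ### Linear images of Gaussians and simultaneous diagonalization -/

/-- The centered Gaussian law with covariance `L diag(v) Lᵀ` is a linear image of a product of
one-dimensional Gaussian laws. -/
theorem centeredGaussian_eq_map_pi {d : ℕ} {Λ L : Matrix (Fin d) (Fin d) ℝ} {v : Fin d → NNReal}
    (h : L * Matrix.diagonal (fun i => (v i : ℝ)) * L.transpose = Λ) :
    centeredGaussian Λ = (Measure.pi fun i => gaussianReal 0 (v i)).map
      (fun x => WithLp.toLp 2 (L.mulVec x)) := by
  have hΛ : Λ.PosSemidef := by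
    rw [← h]
    refine (Matrix.PosSemidef.diagonal fun i => ?_).mul_mul_conjTranspose_same L
    exact (v i).2
  have hm : Measurable fun x : Fin d → ℝ => WithLp.toLp 2 (L.mulVec x) :=
    ((PiLp.continuous_toLp 2 _).comp (Continuous.matrix_mulVec continuous_const continuous_id)).measurable
  have := Measure.isProbabilityMeasure_map (μ := Measure.pi fun i => gaussianReal 0 (v i)) hm.aemeasurable
  rw [centeredGaussian]
  -- Both characteristic functions are `exp(-½ ∑ v_i (Lᵀt)_i²)`; comparing them also covers singular
  -- `L` and vanishing `v i`.
  apply Measure.ext_of_charFun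
  ext t
  rw [charFun_multivariateGaussian hΛ, charFun_apply, integral_map hm.aemeasurable
    (by fun_prop)]
  have hin : ∀ x : Fin d → ℝ, inner ℝ (WithLp.toLp 2 (L.mulVec x)) t =
      ∑ i, x i * (L.transpose.mulVec t.ofLp) i := by
    intro x
    rw [PiLp.inner_apply]
    simp only [RCLike.inner_apply, conj_trivial]
    change t.ofLp ⬝ᵥ L.mulVec x = x ⬝ᵥ _
    rw [Matrix.dotProduct_mulVec, Matrix.mulVec_transpose, dotProduct_comm]
  simp_rw [hin, Complex.ofReal_sum, Finset.sum_mul, Complex.exp_sum]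
  rw [integral_fintype_prod_eq_prod (f := fun i (x : ℝ) =>
    Complex.exp (((x * (L.transpose.mulVec t.ofLp) i : ℝ) : ℂ) * Complex.I))]
  have h1 : ∀ i, ∫ x : ℝ, Complex.exp (((x * (L.transpose.mulVec t.ofLp) i : ℝ) : ℂ) * Complex.I)
      ∂(gaussianReal 0 (v i)) =
      Complex.exp (((-(v i * (L.transpose.mulVec t.ofLp) i ^ 2 / 2) : ℝ) : ℂ)) := by
    intro i
    have := charFun_gaussianReal (μ := 0) (v := v i) ((L.transpose.mulVec t.ofLp) i)
    rw [charFun_apply_real] at this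
    simp only [Complex.ofReal_zero, mul_zero, zero_mul, zero_sub] at this
    convert this using 2
    · ext x; push_cast; ring_nf
    · push_cast; ring_nf
  simp_rw [h1]
  rw [← Complex.exp_sum, ← Complex.ofReal_sum]
  simp only [inner_zero_right, Complex.ofReal_zero, zero_mul, zero_sub]
  rw [← Complex.ofReal_ofNat, ← Complex.ofReal_div, ← Complex.ofReal_neg]
  congr 2
  rw [Finset.sum_neg_distrib, ← Finset.sum_div, ← h]
  congr 2
  rw [← Matrix.mulVec_mulVec, ← Matrix.mulVec_mulVec, Matrix.dotProduct_mulVec,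
    ← Matrix.mulVec_transpose]
  simp only [dotProduct, Matrix.mulVec_diagonal]
  exact Finset.sum_congr rfl fun i _ => by ring

theorem dotProduct_mul_diagonal_mul_transpose {n : Type*} [Fintype n] [DecidableEq n]
    (L : Matrix n n ℝ) (v w : n → ℝ) :
    w ⬝ᵥ (L * Matrix.diagonal v * L.transpose).mulVec w = ∑ i, v i * (L.transpose.mulVec w i) ^ 2 := by
  rw [← Matrix.mulVec_mulVec, ← Matrix.mulVec_mulVec, Matrix.dotProduct_mulVec,
    ← Matrix.mulVec_transpose]
  simp only [dotProduct, Matrix.mulVec_diagonal]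
  exact Finset.sum_congr rfl fun i _ => by ring

open scoped MatrixOrder in
/-- A positive definite and a symmetric matrix are simultaneously diagonalized by congruence. -/
theorem exists_simultaneous_diagonalization {n : Type*} [Fintype n] [DecidableEq n]
    {Λ N : Matrix n n ℝ} (hΛ : Λ.PosDef) (hN : N.IsHermitian) :
    ∃ (L : Matrix n n ℝ) (v : n → ℝ), IsUnit L.det ∧ L * L.transpose = Λ ∧
      L * Matrix.diagonal v * L.transpose = N := by
  -- `L = HU`, where `H = √Λ` and the orthogonal `U` diagonalizes `H⁻¹NH⁻¹`.
  set H := CFC.sqrt Λ with hH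
  have hHH : H * H = Λ := CFC.sqrt_mul_sqrt_self _ hΛ.posSemidef.nonneg
  have hHt : H.transpose = H := (CFC.sqrt_nonneg Λ).isSelfAdjoint
  have hHu : IsUnit H.det := by
    have h1 : IsUnit Λ.det := (Matrix.isUnit_iff_isUnit_det _).1 hΛ.isUnit
    rw [← hHH, Matrix.det_mul] at h1
    exact isUnit_of_mul_isUnit_left h1
  have hK : (H⁻¹ * N * H⁻¹).IsHermitian := by
    rw [Matrix.IsHermitian, Matrix.conjTranspose_mul, Matrix.conjTranspose_mul, hN.eq,
      Matrix.conjTranspose_eq_transpose_of_trivial, Matrix.transpose_nonsing_inv, hHt,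
      Matrix.mul_assoc]
  set U : Matrix n n ℝ := hK.eigenvectorUnitary.1
  have hUU : U * U.transpose = 1 := Unitary.coe_mul_star_self hK.eigenvectorUnitary
  have hsp : H⁻¹ * N * H⁻¹ = U * Matrix.diagonal hK.eigenvalues * U.transpose := by
    conv_lhs => rw [hK.spectral_theorem]
    rfl
  refine ⟨H * U, hK.eigenvalues, ?_, ?_, ?_⟩
  · rw [Matrix.det_mul]
    refine hHu.mul ?_
    have h1 : U.det * U.transpose.det = 1 := by rw [← Matrix.det_mul, hUU, Matrix.det_one]
    exact IsUnit.of_mul_eq_one _ h1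
  · rw [Matrix.transpose_mul, hHt, Matrix.mul_assoc, ← Matrix.mul_assoc U, hUU, Matrix.one_mul, hHH]
  · calc H * U * Matrix.diagonal hK.eigenvalues * (H * U).transpose
        = H * (U * Matrix.diagonal hK.eigenvalues * U.transpose) * H := by
          rw [Matrix.transpose_mul, hHt]; simp only [Matrix.mul_assoc]
      _ = (H * H⁻¹) * N * (H⁻¹ * H) := by rw [← hsp]; simp only [Matrix.mul_assoc]
      _ = N := by rw [Matrix.mul_nonsing_inv _ hHu, Matrix.nonsing_inv_mul _ hHu]; simp

/-- The vector `w = L⁻ᵀe_i` exhibits `v i` as a value of the form of `N` on the unit level of the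
form of `Λ`, so a relative bound between the forms bounds each `v i`. -/
theorem exists_transpose_mulVec_eq_single {n : Type*} [Fintype n] [DecidableEq n]
    {L : Matrix n n ℝ} (hL : IsUnit L.det) (v : n → ℝ) (i : n) :
    ∃ w : n → ℝ, w ≠ 0 ∧ w ⬝ᵥ (L * L.transpose).mulVec w = 1 ∧
      w ⬝ᵥ (L * Matrix.diagonal v * L.transpose).mulVec w = v i := by
  have hLt : IsUnit L.transpose.det := by rwa [Matrix.det_transpose]
  have h : L.transpose.mulVec (L.transpose⁻¹.mulVec (Pi.single i 1)) = Pi.single i 1 := by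
    rw [Matrix.mulVec_mulVec, Matrix.mul_nonsing_inv _ hLt, Matrix.one_mulVec]
  refine ⟨L.transpose⁻¹.mulVec (Pi.single i 1), fun h0 => ?_, ?_, ?_⟩
  · rw [h0, Matrix.mulVec_zero] at h
    simpa using congrFun h i
  · have := dotProduct_mul_diagonal_mul_transpose L 1 (L.transpose⁻¹.mulVec (Pi.single i 1))
    rw [h] at this
    simpa [Matrix.diagonal_one, Pi.single_apply] using this
  · rw [dotProduct_mul_diagonal_mul_transpose, h]
    simp [Pi.single_apply]

/-! ### Total variation and convex distance of Gaussian laws -/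

instance {d : ℕ} (Λ : Matrix (Fin d) (Fin d) ℝ) : IsProbabilityMeasure (centeredGaussian Λ) := by
  unfold centeredGaussian
  infer_instance

theorem abs_measureReal_sub_le_one {Ω : Type*} [MeasurableSpace Ω] (P Q : Measure Ω)
    [IsProbabilityMeasure P] [IsProbabilityMeasure Q] (B : Set Ω) : |P.real B - Q.real B| ≤ 1 := by
  have h1 := measureReal_nonneg (μ := P) (s := B)
  have h2 := measureReal_nonneg (μ := Q) (s := B)
  have h3 := measureReal_le_one (μ := P) (s := B)
  have h4 := measureReal_le_one (μ := Q) (s := B)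
  rw [abs_le]
  constructor <;> linarith

theorem tvDistance_le_one {d : ℕ} (P Q : Measure (EuclideanSpace ℝ (Fin d)))
    [IsProbabilityMeasure P] [IsProbabilityMeasure Q] : tvDistance P Q ≤ 1 :=
  Real.iSup_le (fun B => abs_measureReal_sub_le_one P Q B.1) zero_le_one

theorem measurable_toLp_mulVec {d : ℕ} (L : Matrix (Fin d) (Fin d) ℝ) :
    Measurable fun x : Fin d → ℝ => WithLp.toLp 2 (L.mulVec x) :=
  ((PiLp.continuous_toLp 2 _).comp
    (Continuous.matrix_mulVec continuous_const continuous_id)).measurable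

/-- Centered Gaussian laws whose covariance forms differ by a relative error `ε` are within
`√(2d) ε` in total variation. -/
theorem tvDistance_centeredGaussian_le {d : ℕ} {Λ N : Matrix (Fin d) (Fin d) ℝ}
    (hΛ : Λ.PosDef) (hN : N.PosSemidef) {ε : ℝ} (hε0 : 0 ≤ ε) (hε : ε ≤ 1 / 2)
    (hdε : d * ε ^ 2 ≤ 1)
    (h : ∀ w, |w ⬝ᵥ N.mulVec w - w ⬝ᵥ Λ.mulVec w| ≤ ε * (w ⬝ᵥ Λ.mulVec w)) :
    tvDistance (centeredGaussian N) (centeredGaussian Λ) ≤ Real.sqrt (2 * d) * ε := by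
  obtain ⟨L, v, hL, h1, h2⟩ := exists_simultaneous_diagonalization hΛ hN.isHermitian
  have hv : ∀ i, |v i - 1| ≤ ε := fun i => by
    obtain ⟨w, -, hw1, hw2⟩ := exists_transpose_mulVec_eq_single hL v i
    have := h w
    rwa [← h1, ← h2, hw1, hw2, mul_one] at this
  have hv0 : ∀ i, 0 ≤ v i := fun i => by
    have := (abs_le.1 (hv i)).1
    linarith
  lift v to Fin d → NNReal using hv0
  -- Both laws are images of product Gaussians under the same `L`, so preimages reduce the claim to
  -- the product case.
  rw [centeredGaussian_eq_map_pi (v := v) h2,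
    centeredGaussian_eq_map_pi (L := L) (v := fun _ => 1) (by simpa using h1)]
  refine Real.iSup_le (fun B => ?_) (by positivity)
  rw [map_measureReal_apply (measurable_toLp_mulVec L) B.2,
    map_measureReal_apply (measurable_toLp_mulVec L) B.2]
  simpa using abs_pi_gaussianReal_sub_le (v := v) hv hε (by simpa using hdε) hε0
    (measurable_toLp_mulVec L B.2)

/-- Frontiers of convex sets are Lebesgue null, and the law is the image under a linear isomorphism
of a law with a Lebesgue density. -/
theorem centeredGaussian_frontier_eq_zero {d : ℕ} {Λ : Matrix (Fin d) (Fin d) ℝ} (hΛ : Λ.PosDef)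
    {B : Set (EuclideanSpace ℝ (Fin d))} (hB : Convex ℝ B) :
    centeredGaussian Λ (frontier B) = 0 := by
  obtain ⟨L, v, hL, h1, -⟩ := exists_simultaneous_diagonalization hΛ hΛ.isHermitian
  rw [centeredGaussian_eq_map_pi (L := L) (v := fun _ => 1) (by simpa using h1),
    Measure.map_apply (measurable_toLp_mulVec L) isClosed_frontier.measurableSet]
  let T : (Fin d → ℝ) ≃L[ℝ] EuclideanSpace ℝ (Fin d) :=
    ((Matrix.toLinearEquiv' L (Matrix.invertibleOfIsUnitDet L hL)).trans
      (WithLp.linearEquiv 2 ℝ (Fin d → ℝ)).symm).toContinuousLinearEquiv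
  have hT : (fun x : Fin d → ℝ => WithLp.toLp 2 (L.mulVec x)) = T.toHomeomorph := by
    ext x
    simp [T]
    rfl
  rw [hT, T.toHomeomorph.preimage_frontier]
  rw [pi_gaussianReal_eq_withDensity fun _ => one_pos]
  refine withDensity_absolutelyContinuous _ _ (Convex.addHaar_frontier volume ?_)
  exact hB.linear_preimage T.toLinearEquiv.toLinearMap

/-- Convex sets are no better than Borel sets at telling nondegenerate Gaussian laws apart. -/
theorem convexDistance_le_tvDistance {d : ℕ} {Λ N : Matrix (Fin d) (Fin d) ℝ} (hΛ : Λ.PosDef)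
    (hN : N.PosDef) :
    convexDistance (centeredGaussian N) (centeredGaussian Λ) ≤
      tvDistance (centeredGaussian N) (centeredGaussian Λ) := by
  -- A convex set may be replaced by its interior, which is open and hence Borel.
  have hint : ∀ {M : Matrix (Fin d) (Fin d) ℝ}, M.PosDef → ∀ {B : Set (EuclideanSpace ℝ (Fin d))},
      Convex ℝ B → (centeredGaussian M).real B = (centeredGaussian M).real (interior B) := by
    intro M hM B hB
    refine measureReal_congr (Filter.EventuallyEq.symm ?_)
    exact interior_ae_eq_of_null_frontier (centeredGaussian_frontier_eq_zero hM hB)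
  have hbdd : BddAbove (Set.range fun B : {B : Set (EuclideanSpace ℝ (Fin d)) // MeasurableSet B} =>
      |(centeredGaussian N).real B.1 - (centeredGaussian Λ).real B.1|) :=
    ⟨1, by rintro _ ⟨B, rfl⟩; exact abs_measureReal_sub_le_one _ _ _⟩
  have : Nonempty {B : Set (EuclideanSpace ℝ (Fin d)) // Convex ℝ B} := ⟨⟨∅, convex_empty⟩⟩
  refine ciSup_le fun B => ?_
  rw [hint hN B.2, hint hΛ B.2]
  exact le_ciSup hbdd ⟨interior B.1, isOpen_interior.measurableSet⟩

/-! ### Stepsize estimates -/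

theorem add_one_rpow_le_two_mul {α : ℝ} {t : ℕ} (ht : 1 ≤ t) (hα0 : 0 ≤ α) (hα : α ≤ 1) :
    ((t : ℝ) + 1) ^ α ≤ 2 * (t : ℝ) ^ α := by
  have h0 : (1 : ℝ) ≤ t := by exact_mod_cast ht
  calc ((t : ℝ) + 1) ^ α ≤ (2 * t) ^ α := Real.rpow_le_rpow (by positivity) (by linarith) hα0
    _ = 2 ^ α * t ^ α := Real.mul_rpow (by norm_num) (by positivity)
    _ ≤ 2 * t ^ α := by
        gcongr
        simpa using Real.rpow_le_rpow_of_exponent_le (x := 2) (by norm_num) hα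

section Stepsize

variable {η₀ α : ℝ}

theorem stepsize_pos (hη : 0 < η₀) {t : ℕ} (ht : 1 ≤ t) : 0 < stepsize η₀ α t := by
  have : (0 : ℝ) < t := by exact_mod_cast ht
  unfold stepsize
  positivity

theorem stepsize_anti (hη : 0 < η₀) (hα : 0 < α) {s t : ℕ} (hs : 1 ≤ s) (hst : s ≤ t) :
    stepsize η₀ α t ≤ stepsize η₀ α s := by
  have h0 : (0 : ℝ) < s := by exact_mod_cast hs
  have h1 : (s : ℝ) ≤ t := by exact_mod_cast hst
  exact mul_le_mul_of_nonneg_left (Real.rpow_le_rpow_of_nonpos h0 h1 (by linarith)) hη.le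

theorem inv_stepsize (t : ℕ) : (stepsize η₀ α t)⁻¹ = (t : ℝ) ^ α / η₀ := by
  rw [stepsize, Real.rpow_neg (Nat.cast_nonneg t), mul_inv, inv_inv, div_eq_mul_inv, mul_comm]

/-- The ratio of consecutive stepsizes is `(t/(t+1))^α`, at least `t/(t+1)` since `α < 1`. -/
theorem stepsize_sub_succ_le (hη : 0 < η₀) (hα : α < 1) {t : ℕ} (ht : 1 ≤ t) :
    stepsize η₀ α t - stepsize η₀ α (t + 1) ≤ stepsize η₀ α t / t := by
  have h0 : (0 : ℝ) < t := by exact_mod_cast ht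
  have h2 : ((t : ℝ) / (t + 1)) ≤ (t / (t + 1)) ^ α := by
    have hle : (t : ℝ) / (t + 1) ≤ 1 := by rw [div_le_one (by positivity)]; linarith
    simpa using Real.rpow_le_rpow_of_exponent_ge (by positivity) hle hα.le
  have h3 : stepsize η₀ α (t + 1) = stepsize η₀ α t * ((t : ℝ) / (t + 1)) ^ α := by
    rw [stepsize, stepsize, Real.div_rpow h0.le (by positivity), Real.rpow_neg h0.le,
      Real.rpow_neg (by positivity)]
    push_cast
    have : (0 : ℝ) < (t : ℝ) ^ α := by positivity
    field_simp
  have h4 := stepsize_pos (α := α) hη ht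
  rw [h3]
  have h5 : stepsize η₀ α t * ((t : ℝ) / (t + 1)) ≤ stepsize η₀ α t * (t / (t + 1)) ^ α := by gcongr
  have h6 : stepsize η₀ α t - stepsize η₀ α t * ((t : ℝ) / (t + 1)) = stepsize η₀ α t / (t + 1) := by
    field_simp; ring
  have h7 : stepsize η₀ α t / (t + 1) ≤ stepsize η₀ α t / t := by gcongr; linarith
  linarith

/-- Since `α < 1`, the increments of `1/η_t` tend to zero; this slow variation drives the downward
inductions below. -/
theorem inv_stepsize_succ_sub_le (hη : 0 < η₀) (hα0 : 0 < α) (hα : α < 1) {t : ℕ} (ht : 1 ≤ t) :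
    (stepsize η₀ α (t + 1))⁻¹ - (stepsize η₀ α t)⁻¹ ≤ (t : ℝ) ^ (α - 1) * (2 / η₀) := by
  have h0 : (0 : ℝ) < t := by exact_mod_cast ht
  have h1 := stepsize_pos (α := α) hη ht
  have h2 := stepsize_pos (α := α) hη (Nat.le_add_left 1 t)
  have h3 := stepsize_sub_succ_le hη hα ht
  have e : (stepsize η₀ α (t + 1))⁻¹ - (stepsize η₀ α t)⁻¹ =
      (stepsize η₀ α t - stepsize η₀ α (t + 1)) / stepsize η₀ α t * (stepsize η₀ α (t + 1))⁻¹ := by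
    field_simp
  have h4 : (stepsize η₀ α t - stepsize η₀ α (t + 1)) / stepsize η₀ α t ≤ 1 / t := by
    rw [div_le_iff₀ h1]
    calc _ ≤ _ := h3
      _ = _ := by ring
  rw [e]
  calc _ ≤ 1 / (t : ℝ) * (stepsize η₀ α (t + 1))⁻¹ := by gcongr
    _ = ((t : ℝ) + 1) ^ α / (t * η₀) := by rw [inv_stepsize]; push_cast; field_simp
    _ ≤ (2 * t ^ α) / (t * η₀) := by
        gcongr
        exact add_one_rpow_le_two_mul ht hα0.le hα.le
    _ = _ := by
        rw [Real.rpow_sub_one h0.ne']; field_simp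

open Filter Topology in
theorem tendsto_stepsize (hα : 0 < α) : Tendsto (stepsize η₀ α) atTop (𝓝 0) := by
  have := ((tendsto_rpow_neg_atTop hα).comp tendsto_natCast_atTop_atTop).const_mul η₀
  rw [mul_zero] at this
  exact this

/-- Bernoulli's inequality for `(1 - 1/(n+1))^β` gives `β(n+1)^(β-1) ≤ (n+1)^β - n^β`, which
telescopes. -/
theorem sum_rpow_le {β : ℝ} (h0 : 0 < β) (h1 : β ≤ 1) (T : ℕ) :
    ∑ t ∈ Finset.Icc 1 T, (t : ℝ) ^ (β - 1) ≤ (T : ℝ) ^ β / β := by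
  induction T with
  | zero => simp [Real.zero_rpow h0.ne']
  | succ n ih =>
    rw [Finset.sum_Icc_succ_top (by omega)]
    have hn : (0 : ℝ) < (n : ℝ) + 1 := by positivity
    have hB := rpow_one_add_le_one_add_mul_self (s := -((n : ℝ) + 1)⁻¹)
      (by rw [neg_le_neg_iff]; exact inv_le_one_of_one_le₀ (by linarith [n.cast_nonneg (α := ℝ)]))
      h0.le h1
    have e1 : 1 + -((n : ℝ) + 1)⁻¹ = n / (n + 1) := by field_simp; ring
    rw [e1, Real.div_rpow n.cast_nonneg hn.le, div_le_iff₀ (by positivity)] at hB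
    push_cast
    rw [Real.rpow_sub_one hn.ne']
    rw [le_div_iff₀ h0] at ih ⊢
    have e2 : (1 + β * -((n : ℝ) + 1)⁻¹) * ((n : ℝ) + 1) ^ β =
      ((n : ℝ) + 1) ^ β - ((n : ℝ) + 1) ^ β / (n + 1) * β := by ring
    rw [add_mul]
    linarith

end Stepsize

/-! ### Backward recursions for the error `A Q_t - I` -/

/-- Induction downwards from `T + 1` to `t₀`. -/
theorem le_of_backward_step {x b : ℕ → ℝ} {t₀ T : ℕ} (hT : x (T + 1) ≤ b (T + 1))
    (h : ∀ t, t₀ ≤ t → t ≤ T → x (t + 1) ≤ b (t + 1) → x t ≤ b t) {t : ℕ} (h0 : t₀ ≤ t)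
    (h1 : t ≤ T + 1) : x t ≤ b t := by
  refine Nat.decreasingInduction' (P := fun t => x t ≤ b t) (fun k hk hk' hx => ?_) h1 hT
  exact h k (h0.trans hk') (by omega) hx

section Recursion

open scoped Matrix.Norms.L2Operator

variable {d : ℕ} (A : Matrix (Fin d) (Fin d) ℝ) (η₀ α : ℝ)

/-- The sum `∑_{j=t}^{T} ∏_{k=t+1}^{j} (I - η_k A)`, so that `Q_t` is `η_t` times it. -/
noncomputable def stepSum (T t : ℕ) : Matrix (Fin d) (Fin d) ℝ :=
  ∑ j ∈ Finset.Icc t T, stepProd A η₀ α t j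

theorem stepProd_self (t : ℕ) : stepProd A η₀ α t t = 1 := by
  simp [stepProd]

theorem stepProd_eq_mul {t j : ℕ} (h : t < j) :
    stepProd A η₀ α t j = (1 - stepsize η₀ α (t + 1) • A) * stepProd A η₀ α (t + 1) j := by
  rw [stepProd, List.Ico.eq_cons (by omega), List.map_cons, List.prod_cons, stepProd]

theorem stepSum_of_lt {T t : ℕ} (h : T < t) : stepSum A η₀ α T t = 0 := by
  rw [stepSum, Finset.Icc_eq_empty (by omega), Finset.sum_empty]

theorem stepSum_eq_one_add {T t : ℕ} (h : t ≤ T) :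
    stepSum A η₀ α T t =
      1 + (1 - stepsize η₀ α (t + 1) • A) * stepSum A η₀ α T (t + 1) := by
  rw [stepSum, ← Finset.add_sum_Ioc_eq_sum_Icc h, stepProd_self, stepSum, Finset.mul_sum]
  congr 1
  refine Finset.sum_congr (by ext; simp) fun j hj => ?_
  exact stepProd_eq_mul A η₀ α (Finset.mem_Icc.1 hj).1

/-- The error `A Q_t - I`. -/
noncomputable def stepError (T t : ℕ) : Matrix (Fin d) (Fin d) ℝ :=
  stepsize η₀ α t • (A * stepSum A η₀ α T t) - 1

/-- A rearrangement of `stepSum_eq_one_add`; it turns the sum of the errors into a telescoping sum.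
-/
theorem stepError_succ {T t : ℕ} (h : t ≤ T) :
    stepError A η₀ α T (t + 1) = stepSum A η₀ α T (t + 1) - stepSum A η₀ α T t := by
  rw [stepError, stepSum_eq_one_add A η₀ α h, sub_mul, one_mul, smul_mul_assoc]
  abel

theorem sum_stepError (T : ℕ) :
    ∑ t ∈ Finset.Icc 1 T, stepError A η₀ α T t = 1 - stepSum A η₀ α T 0 := by
  have h1 : ∀ n, n ≤ T → ∑ t ∈ Finset.Icc 1 n, stepError A η₀ α T t =
      stepSum A η₀ α T n - stepSum A η₀ α T 0 := by
    intro n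
    induction n with
    | zero => simp
    | succ n ih =>
      intro hn
      rw [Finset.sum_Icc_succ_top (by omega), ih (by omega), stepError_succ A η₀ α (by omega)]
      abel
  rw [h1 T le_rfl, stepSum_eq_one_add A η₀ α le_rfl, stepSum_of_lt A η₀ α (Nat.lt_succ_self T),
    mul_zero, add_zero]

/-- The part of the error `A Q_t - I` that is due to the variation of the stepsizes. -/
noncomputable def stepDrift (T t : ℕ) : Matrix (Fin d) (Fin d) ℝ :=
  stepError A η₀ α T t + stepProd A η₀ α t (T + 1)

/-- Running the product to `T + 1`, one factor past the horizon, makes the drift start from zero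
here; with constant stepsizes it would vanish for all `t ≤ T + 1`. -/
theorem stepDrift_last (T : ℕ) : stepDrift A η₀ α T (T + 1) = 0 := by
  simp [stepDrift, stepError, stepSum_of_lt A η₀ α (Nat.lt_succ_self T), stepProd_self]

/-- The drift is propagated by the contractions `I - η_{t+1}A` and forced only by stepsize
differences. -/
theorem stepDrift_eq_add {T t : ℕ} (h : t ≤ T) :
    stepDrift A η₀ α T t =
      (stepsize η₀ α t - stepsize η₀ α (t + 1)) • (A * stepSum A η₀ α T t) +
        (1 - stepsize η₀ α (t + 1) • A) * stepDrift A η₀ α T (t + 1) := by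
  rw [stepDrift, stepDrift, stepError, stepError, stepProd_eq_mul A η₀ α (Nat.lt_succ_of_le h),
    sub_smul]
  have e := stepSum_eq_one_add A η₀ α h
  have e2 : stepsize η₀ α (t + 1) • (A * stepSum A η₀ α T t) =
      stepsize η₀ α (t + 1) • A + (1 - stepsize η₀ α (t + 1) • A) *
        (stepsize η₀ α (t + 1) • (A * stepSum A η₀ α T (t + 1))) := by
    rw [e]
    simp only [mul_add, mul_one, sub_mul, one_mul, smul_add, mul_sub, smul_mul_assoc,
      mul_smul_comm, smul_sub]
  rw [e2]
  noncomm_ring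

theorem norm_one_matrix_le : ‖(1 : Matrix (Fin d) (Fin d) ℝ)‖ ≤ 1 := by
  rw [Matrix.cstar_norm_def, map_one]
  exact ContinuousLinearMap.norm_id_le

variable {A η₀ α}

/-- One backward step turns the bound `2/(qη_{t+1})` into `2/(qη_{t+1}) - 1`; the spare `1` absorbs
the change of `1/η`, at most `q/2`. -/
theorem norm_stepSum_le {q : ℝ} {t₀ T t : ℕ} (hη : 0 < η₀) (hq : 0 < q)
    (hρ : ∀ t, t₀ ≤ t → ‖1 - stepsize η₀ α t • A‖ ≤ 1 - q * stepsize η₀ α t)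
    (hu : ∀ t, t₀ ≤ t → (stepsize η₀ α (t + 1))⁻¹ - (stepsize η₀ α t)⁻¹ ≤ q / 2)
    (h0 : t₀ ≤ t) (h1 : t ≤ T + 1) :
    ‖stepSum A η₀ α T t‖ ≤ 2 / q * (stepsize η₀ α t)⁻¹ := by
  refine le_of_backward_step (x := fun t => ‖stepSum A η₀ α T t‖)
    (b := fun t => 2 / q * (stepsize η₀ α t)⁻¹) (t₀ := t₀) ?_ (fun t ht htT ih => ?_) h0 h1
  · simp only [stepSum_of_lt A η₀ α (Nat.lt_succ_self T), norm_zero]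
    have := stepsize_pos (α := α) hη (Nat.le_add_left 1 T)
    positivity
  · rw [stepSum_eq_one_add A η₀ α htT]
    have hs := stepsize_pos (α := α) hη (Nat.le_add_left 1 t)
    have hr := hρ (t + 1) (by omega)
    have h2 : 2 / q * ((stepsize η₀ α (t + 1))⁻¹ - (stepsize η₀ α t)⁻¹) ≤ 1 := by
      calc _ ≤ 2 / q * (q / 2) := by gcongr; exact hu t ht
        _ = 1 := by field_simp
    calc _ ≤ 1 + (1 - q * stepsize η₀ α (t + 1)) * (2 / q * (stepsize η₀ α (t + 1))⁻¹) := by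
          refine (norm_add_le _ _).trans (add_le_add norm_one_matrix_le ?_)
          refine (norm_mul_le _ _).trans (mul_le_mul hr ih (norm_nonneg _) ?_)
          exact (norm_nonneg _).trans hr
      _ = 2 / q * (stepsize η₀ α (t + 1))⁻¹ - 1 := by field_simp; ring
      _ ≤ _ := by linarith

/-- For fixed `t` the partial sums are bounded uniformly in the horizon `T`. -/
theorem exists_norm_stepSum_le {q : ℝ} {t₀ : ℕ} (hη : 0 < η₀) (hq : 0 < q) (ht₀ : 1 ≤ t₀)
    (hρ : ∀ t, t₀ ≤ t → ‖1 - stepsize η₀ α t • A‖ ≤ 1 - q * stepsize η₀ α t)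
    (hu : ∀ t, t₀ ≤ t → (stepsize η₀ α (t + 1))⁻¹ - (stepsize η₀ α t)⁻¹ ≤ q / 2) (t : ℕ) :
    ∃ K, 0 ≤ K ∧ ∀ T, ‖stepSum A η₀ α T t‖ ≤ K := by
  have base : ∀ t, t₀ ≤ t → ∃ K, 0 ≤ K ∧ ∀ T, ‖stepSum A η₀ α T t‖ ≤ K := by
    intro t ht
    have hs := stepsize_pos (α := α) hη (ht₀.trans ht)
    refine ⟨2 / q * (stepsize η₀ α t)⁻¹, by positivity, fun T => ?_⟩
    rcases le_or_gt t (T + 1) with h | h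
    · exact norm_stepSum_le hη hq hρ hu ht h
    · rw [stepSum_of_lt A η₀ α (by omega), norm_zero]
      positivity
  rcases le_total t₀ t with h | h
  · exact base t h
  refine Nat.decreasingInduction' (P := fun t => ∃ K, 0 ≤ K ∧ ∀ T, ‖stepSum A η₀ α T t‖ ≤ K)
    (fun k _ _ hx => ?_) h (base t₀ le_rfl)
  obtain ⟨K, hK0, hK⟩ := hx
  refine ⟨1 + ‖1 - stepsize η₀ α (k + 1) • A‖ * K, by positivity, fun T => ?_⟩
  rcases le_or_gt k T with hkT | hkT
  · rw [stepSum_eq_one_add A η₀ α hkT]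
    refine (norm_add_le _ _).trans (add_le_add norm_one_matrix_le ?_)
    refine (norm_mul_le _ _).trans ?_
    gcongr
    exact hK T
  · rw [stepSum_of_lt A η₀ α hkT, norm_zero]
    positivity

/-- The forcing is at most `2‖A‖/(qt)`. Because `η_{t+1}(t+1)^(α-1) = η₀/(t+1)`, contraction gains
`4‖A‖/(q(t+1))` with this constant, which is enough as `t + 1 ≤ 2t`. -/
theorem norm_stepDrift_le {q : ℝ} {t₀ T t : ℕ} (hη : 0 < η₀) (hα0 : 0 < α) (hα : α < 1)
    (hq : 0 < q) (ht₀ : 1 ≤ t₀)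
    (hρ : ∀ t, t₀ ≤ t → ‖1 - stepsize η₀ α t • A‖ ≤ 1 - q * stepsize η₀ α t)
    (hu : ∀ t, t₀ ≤ t → (stepsize η₀ α (t + 1))⁻¹ - (stepsize η₀ α t)⁻¹ ≤ q / 2)
    (h0 : t₀ ≤ t) (h1 : t ≤ T + 1) :
    ‖stepDrift A η₀ α T t‖ ≤ 4 * ‖A‖ / (q ^ 2 * η₀) * (t : ℝ) ^ (α - 1) := by
  refine le_of_backward_step (x := fun t => ‖stepDrift A η₀ α T t‖)
    (b := fun t => 4 * ‖A‖ / (q ^ 2 * η₀) * (t : ℝ) ^ (α - 1)) (t₀ := t₀) ?_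
    (fun t ht htT ih => ?_) h0 h1
  · simp only [stepDrift_last, norm_zero]
    positivity
  · rw [stepDrift_eq_add A η₀ α htT]
    have ht1 : 1 ≤ t := ht₀.trans ht
    have ht' : (1 : ℝ) ≤ t := by exact_mod_cast ht1
    have hs := stepsize_pos (α := α) hη (Nat.le_add_left 1 t)
    have hs0 := stepsize_pos (α := α) hη ht1
    have hr := hρ (t + 1) (by omega)
    have hd := stepsize_sub_succ_le hη hα ht1
    have hd0 := stepsize_anti hη hα0 ht1 (Nat.le_succ t)
    set K := 4 * ‖A‖ / (q ^ 2 * η₀) with hK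
    have hK0 : 0 ≤ K := by positivity
    have h2 : ‖(stepsize η₀ α t - stepsize η₀ α (t + 1)) • (A * stepSum A η₀ α T t)‖ ≤
        ‖A‖ * (2 / q) / t := by
      rw [norm_smul, Real.norm_eq_abs, abs_of_nonneg (by linarith)]
      calc _ ≤ stepsize η₀ α t / t * (‖A‖ * (2 / q * (stepsize η₀ α t)⁻¹)) := by
            refine mul_le_mul hd ((norm_mul_le _ _).trans ?_) (norm_nonneg _) (by positivity)
            gcongr
            exact norm_stepSum_le hη hq hρ hu ht (by omega)
        _ = _ := by field_simp
    have h3 : ‖(1 - stepsize η₀ α (t + 1) • A) * stepDrift A η₀ α T (t + 1)‖ ≤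
        (1 - q * stepsize η₀ α (t + 1)) * (K * ((t + 1 : ℕ) : ℝ) ^ (α - 1)) :=
      (norm_mul_le _ _).trans (mul_le_mul hr ih (norm_nonneg _) ((norm_nonneg _).trans hr))
    have h4 : stepsize η₀ α (t + 1) * ((t + 1 : ℕ) : ℝ) ^ (α - 1) = η₀ / (t + 1) := by
      have : (0 : ℝ) < (t : ℝ) + 1 := by positivity
      rw [stepsize, mul_assoc, ← Real.rpow_add (by positivity)]
      push_cast
      rw [show -α + (α - 1) = -1 by ring, Real.rpow_neg_one, div_eq_mul_inv]
    have h5 : ((t + 1 : ℕ) : ℝ) ^ (α - 1) ≤ (t : ℝ) ^ (α - 1) :=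
      Real.rpow_le_rpow_of_nonpos (by positivity) (by push_cast; linarith) (by linarith)
    have h6 : ‖A‖ * (2 / q) / t ≤ q * K * (η₀ / (t + 1)) := by
      rw [hK]
      have e : q * (4 * ‖A‖ / (q ^ 2 * η₀)) * (η₀ / ((t : ℝ) + 1)) =
          ‖A‖ * (2 / q) * (2 / (t + 1)) := by field_simp; ring
      rw [e, div_eq_mul_inv (‖A‖ * (2 / q))]
      gcongr
      rw [inv_eq_one_div, div_le_div_iff₀ (by positivity) (by positivity)]
      linarith
    refine (norm_add_le _ _).trans ((add_le_add h2 h3).trans ?_)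
    have e : (1 - q * stepsize η₀ α (t + 1)) * (K * ((t + 1 : ℕ) : ℝ) ^ (α - 1)) =
        K * ((t + 1 : ℕ) : ℝ) ^ (α - 1) - q * K * (η₀ / (t + 1)) := by
      rw [← h4]; ring
    rw [e]
    have := mul_le_mul_of_nonneg_left h5 hK0
    linarith

/-- With `P_t` the product and `b = cη_{T+1}`, contraction gives `b‖P_t‖² ≤ ‖P_{t+1}‖² - ‖P_t‖²`,
because `(1+y)(1-y) ≤ 1` and `b ≤ y = cη_{t+1}`. These inequalities telescope. -/
theorem sum_norm_stepProd_sq_le {c : ℝ} {t₀ T : ℕ} (hη : 0 < η₀) (hα0 : 0 < α)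
    (hc : 0 < c)
    (hρ : ∀ t, t₀ ≤ t → ‖1 - stepsize η₀ α t • A‖ ^ 2 ≤ 1 - c * stepsize η₀ α t)
    (h1 : t₀ ≤ T + 1) :
    ∑ t ∈ Finset.Ico t₀ (T + 1), ‖stepProd A η₀ α t (T + 1)‖ ^ 2 ≤
      (c * stepsize η₀ α (T + 1))⁻¹ := by
  have hs := stepsize_pos (α := α) hη (Nat.le_add_left 1 T)
  set b := c * stepsize η₀ α (T + 1) with hb
  have hb0 : 0 < b := by positivity
  have key := le_of_backward_step
    (x := fun t => b * ∑ s ∈ Finset.Ico t (T + 1), ‖stepProd A η₀ α s (T + 1)‖ ^ 2)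
    (b := fun t => 1 - ‖stepProd A η₀ α t (T + 1)‖ ^ 2) (t₀ := t₀) (T := T)
    ?_ (fun t ht htT ih => ?_) le_rfl h1
  · rw [inv_eq_one_div, le_div_iff₀' hb0]
    linarith [sq_nonneg ‖stepProd A η₀ α t₀ (T + 1)‖]
  · simp only [Finset.Ico_self, Finset.sum_empty, mul_zero, stepProd_self]
    have := norm_one_matrix_le (d := d)
    have := norm_nonneg (1 : Matrix (Fin d) (Fin d) ℝ)
    nlinarith
  · rw [Finset.sum_eq_sum_Ico_succ_bot (by omega)]
    set g := ‖stepProd A η₀ α t (T + 1)‖ ^ 2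
    set g' := ‖stepProd A η₀ α (t + 1) (T + 1)‖ ^ 2 with hg'
    set y := c * stepsize η₀ α (t + 1) with hy
    have hgg : g ≤ (1 - y) * g' := by
      simp only [g, hg']
      rw [stepProd_eq_mul A η₀ α (by omega)]
      calc _ ≤ (‖1 - stepsize η₀ α (t + 1) • A‖ * ‖stepProd A η₀ α (t + 1) (T + 1)‖) ^ 2 := by
            gcongr; exact norm_mul_le _ _
        _ ≤ _ := by
            rw [mul_pow]; gcongr; exact hρ (t + 1) (by omega)
    have hby : b ≤ y := by
      rw [hb, hy]; gcongr; exact stepsize_anti hη hα0 (by omega) (by omega)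
    have hg0 : 0 ≤ g' := sq_nonneg _
    have h3 : (1 + b) * g ≤ g' := by
      calc (1 + b) * g ≤ (1 + y) * ((1 - y) * g') := by
            have : 0 ≤ g := sq_nonneg _
            gcongr
            linarith
        _ = g' - y ^ 2 * g' := by ring
        _ ≤ g' := by have := mul_nonneg (sq_nonneg y) hg0; linarith
    linarith

end Recursion

/-! ### Mean squared error and the covariance form -/

section ErrorBound

open scoped Matrix.Norms.L2Operator

variable {d : ℕ} {A Γ : Matrix (Fin d) (Fin d) ℝ} {η₀ α : ℝ}

theorem norm_toLp_sq (x : Fin d → ℝ) : ‖WithLp.toLp 2 x‖ ^ 2 = x ⬝ᵥ x := by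
  rw [EuclideanSpace.real_norm_sq_eq]
  exact Finset.sum_congr rfl fun i _ => sq _

theorem abs_dotProduct_le (x y : Fin d → ℝ) :
    |x ⬝ᵥ y| ≤ ‖WithLp.toLp 2 x‖ * ‖WithLp.toLp 2 y‖ := by
  have := abs_real_inner_le_norm (WithLp.toLp 2 y) (WithLp.toLp 2 x)
  rw [mul_comm]
  simpa [PiLp.inner_apply, dotProduct] using this

theorem norm_toLp_mulVec_le (M : Matrix (Fin d) (Fin d) ℝ) (x : Fin d → ℝ) :
    ‖WithLp.toLp 2 (M.mulVec x)‖ ≤ ‖M‖ * ‖WithLp.toLp 2 x‖ :=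
  Matrix.l2_opNorm_mulVec M (WithLp.toLp 2 x)

theorem norm_transpose_eq (M : Matrix (Fin d) (Fin d) ℝ) : ‖M.transpose‖ = ‖M‖ :=
  Matrix.l2_opNorm_conjTranspose M

/-- Expanding `‖x - ηAx‖²`, coercivity gains `2cη‖x‖²`, and half of it pays for `η²‖Ax‖²`. -/
theorem norm_one_sub_smul_sq_le {c η : ℝ} (hA : ∀ x, c * (x ⬝ᵥ x) ≤ x ⬝ᵥ A.mulVec x) (hη : 0 ≤ η)
    (hηA : η * ‖A‖ ^ 2 ≤ c) (hcη : c * η ≤ 1) : ‖1 - η • A‖ ^ 2 ≤ 1 - c * η := by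
  have h : ‖1 - η • A‖ ≤ Real.sqrt (1 - c * η) := by
    rw [Matrix.cstar_norm_def]
    refine ContinuousLinearMap.opNorm_le_bound _ (Real.sqrt_nonneg _) fun x => ?_
    refine le_of_sq_le_sq ?_ (by positivity)
    rw [mul_pow, Real.sq_sqrt (by linarith), map_sub, map_one, map_smul,
      _root_.sub_apply, _root_.smul_apply, one_apply_eq_self,
      norm_sub_sq_real, inner_smul_right, Matrix.inner_toEuclideanCLM, norm_smul, mul_pow]
    have h1 := hA x.ofLp
    have h2 : x.ofLp ⬝ᵥ x.ofLp = ‖x‖ ^ 2 := (norm_toLp_sq x.ofLp).symm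
    rw [h2] at h1
    have h3 : ‖Matrix.toEuclideanCLM (𝕜 := ℝ) A x‖ ^ 2 ≤ ‖A‖ ^ 2 * ‖x‖ ^ 2 := by
      rw [← mul_pow]
      gcongr
      exact norm_toLp_mulVec_le A x.ofLp
    have h4 : ‖η‖ ^ 2 * ‖Matrix.toEuclideanCLM (𝕜 := ℝ) A x‖ ^ 2 ≤ η * (c * ‖x‖ ^ 2) := by
      rw [Real.norm_eq_abs, sq_abs]
      calc _ ≤ η ^ 2 * (‖A‖ ^ 2 * ‖x‖ ^ 2) := by gcongr
        _ = η * ((η * ‖A‖ ^ 2) * ‖x‖ ^ 2) := by ring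
        _ ≤ _ := by gcongr
    have h5 := mul_le_mul_of_nonneg_left h1 hη
    linarith
  calc _ ≤ Real.sqrt (1 - c * η) ^ 2 := by gcongr
    _ = _ := Real.sq_sqrt (by linarith)

open Filter Topology in
/-- The mean squared error of `A Q_t` is `4 (c η₀)⁻¹ T^(α - 1)` up to lower order terms. -/
theorem exists_sum_norm_stepError_sq_le {c : ℝ} (hc : 0 < c)
    (hA : ∀ x, c * (x ⬝ᵥ x) ≤ x ⬝ᵥ A.mulVec x) (hη : 0 < η₀) (hα0 : 1 / 2 < α) (hα : α < 1) :
    ∃ K, 0 ≤ K ∧ ∀ T : ℕ, 1 ≤ T →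
      ∑ t ∈ Finset.Icc 1 T, ‖stepError A η₀ α T t‖ ^ 2 ≤
        4 / (c * η₀) * (T : ℝ) ^ α + K * (T : ℝ) ^ (2 * α - 1) ∧
      ‖1 - stepSum A η₀ α T 0‖ ≤ K := by
  have hα0' : 0 < α := by linarith
  have hs := tendsto_stepsize (η₀ := η₀) hα0'
  have e1 : ∀ᶠ t : ℕ in atTop, stepsize η₀ α t * ‖A‖ ^ 2 ≤ c := by
    have := hs.mul_const (‖A‖ ^ 2)
    rw [zero_mul] at this
    exact this.eventually_le_const hc
  have e2 : ∀ᶠ t : ℕ in atTop, c * stepsize η₀ α t ≤ 1 := by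
    have := hs.const_mul c
    rw [mul_zero] at this
    exact this.eventually_le_const one_pos
  have e3 : ∀ᶠ t : ℕ in atTop, (t : ℝ) ^ (α - 1) * (2 / η₀) ≤ c / 2 / 2 := by
    have := ((tendsto_rpow_neg_atTop (y := 1 - α) (by linarith)).comp
      tendsto_natCast_atTop_atTop).mul_const (2 / η₀)
    rw [zero_mul] at this
    have := this.eventually_le_const (show 0 < c / 2 / 2 by positivity)
    simpa using this
  obtain ⟨t₀, ht₀⟩ := eventually_atTop.1 (((e1.and e2).and e3).and (eventually_ge_atTop 1))
  have h1 : 1 ≤ t₀ := (ht₀ t₀ le_rfl).2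
  have hρ2 : ∀ t, t₀ ≤ t → ‖1 - stepsize η₀ α t • A‖ ^ 2 ≤ 1 - c * stepsize η₀ α t := fun t ht =>
    norm_one_sub_smul_sq_le hA (stepsize_pos hη (h1.trans ht)).le (ht₀ t ht).1.1.1 (ht₀ t ht).1.1.2
  have hρ : ∀ t, t₀ ≤ t → ‖1 - stepsize η₀ α t • A‖ ≤ 1 - c / 2 * stepsize η₀ α t := by
    intro t ht
    have h2 := (ht₀ t ht).1.1.2
    refine le_of_sq_le_sq ((hρ2 t ht).trans ?_) (by linarith)
    nlinarith [sq_nonneg (c / 2 * stepsize η₀ α t)]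
  have hu : ∀ t, t₀ ≤ t → (stepsize η₀ α (t + 1))⁻¹ - (stepsize η₀ α t)⁻¹ ≤ c / 2 / 2 := fun t ht =>
    (inv_stepsize_succ_sub_le hη hα0' hα (h1.trans ht)).trans (ht₀ t ht).1.2
  have hq : 0 < c / 2 := by positivity
  choose K hK0 hK using exists_norm_stepSum_le hη hq h1 hρ hu
  set D := 4 * ‖A‖ / ((c / 2) ^ 2 * η₀) with hD
  have hD0 : 0 ≤ D := by positivity
  -- The finitely many indices before contraction sets in cost a constant independent of `T`.
  set K₁ := ∑ t ∈ Finset.Ico 1 t₀, (stepsize η₀ α t * (‖A‖ * K t) + 1) ^ 2 with hK₁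
  have hK₁0 : 0 ≤ K₁ := Finset.sum_nonneg fun _ _ => sq_nonneg _
  have hβ : 0 < 2 * α - 1 := by linarith
  refine ⟨2 * D ^ 2 / (2 * α - 1) + K₁ + (1 + K 0), by positivity [hK0 0], fun T hT => ⟨?_, ?_⟩⟩
  · have hT' : (1 : ℝ) ≤ T := by exact_mod_cast hT
    have early : ∀ t ∈ Finset.Ico 1 t₀, ‖stepError A η₀ α T t‖ ^ 2 ≤
        (stepsize η₀ α t * (‖A‖ * K t) + 1) ^ 2 := by
      intro t ht
      have hst := stepsize_pos (α := α) hη (Finset.mem_Ico.1 ht).1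
      gcongr
      refine (norm_sub_le _ _).trans (add_le_add ?_ norm_one_matrix_le)
      rw [norm_smul, Real.norm_eq_abs, abs_of_pos hst]
      gcongr
      exact (norm_mul_le _ _).trans (by gcongr; exact hK t T)
    have late : ∀ t ∈ Finset.Ico t₀ (T + 1), ‖stepError A η₀ α T t‖ ^ 2 ≤
        2 * D ^ 2 * (t : ℝ) ^ (2 * α - 1 - 1) + 2 * ‖stepProd A η₀ α t (T + 1)‖ ^ 2 := by
      intro t ht
      obtain ⟨hta, htb⟩ := Finset.mem_Ico.1 ht
      have ht0 : (0 : ℝ) < t := by exact_mod_cast h1.trans hta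
      have e : stepError A η₀ α T t = stepDrift A η₀ α T t - stepProd A η₀ α t (T + 1) := by
        rw [stepDrift, add_sub_cancel_right]
      have hd := norm_stepDrift_le (T := T) hη hα0' hα hq h1 hρ hu hta htb.le
      rw [← hD] at hd
      have e2 : (t : ℝ) ^ (2 * α - 1 - 1) = ((t : ℝ) ^ (α - 1)) ^ 2 := by
        rw [← Real.rpow_mul_natCast ht0.le]
        congr 1
        push_cast
        ring
      rw [e, e2]
      have h2 : ‖stepDrift A η₀ α T t - stepProd A η₀ α t (T + 1)‖ ≤
          D * (t : ℝ) ^ (α - 1) + ‖stepProd A η₀ α t (T + 1)‖ :=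
        (norm_sub_le _ _).trans (by gcongr)
      calc _ ≤ (D * (t : ℝ) ^ (α - 1) + ‖stepProd A η₀ α t (T + 1)‖) ^ 2 := by gcongr
        _ ≤ _ := by nlinarith [sq_nonneg (D * (t : ℝ) ^ (α - 1) - ‖stepProd A η₀ α t (T + 1)‖)]
    -- The constant `4` is a `2` from `(a + b)² ≤ 2a² + 2b²` times a `2` from `(T+1)^α ≤ 2T^α`. The
    -- drift part is summed with exponent `β = 2α - 1 > 0`.
    have lateSum : ∑ t ∈ Finset.Ico t₀ (T + 1), ‖stepError A η₀ α T t‖ ^ 2 ≤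
        2 * D ^ 2 * ((T : ℝ) ^ (2 * α - 1) / (2 * α - 1)) + 4 / (c * η₀) * (T : ℝ) ^ α := by
      rcases le_or_gt t₀ (T + 1) with h | h
      · refine (Finset.sum_le_sum late).trans ?_
        rw [Finset.sum_add_distrib, ← Finset.mul_sum, ← Finset.mul_sum]
        refine add_le_add ?_ ?_
        · refine mul_le_mul_of_nonneg_left ?_ (by positivity)
          refine le_trans ?_ (sum_rpow_le hβ (by linarith) T)
          refine Finset.sum_le_sum_of_subset_of_nonneg (fun t ht => ?_) fun t _ _ => by positivity
          rw [Finset.mem_Ico] at ht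
          rw [Finset.mem_Icc]
          omega
        · have h2 := sum_norm_stepProd_sq_le hη hα0' hc hρ2 h
          have h3 : (c * stepsize η₀ α (T + 1))⁻¹ ≤ 2 * (T : ℝ) ^ α / (c * η₀) := by
            rw [mul_inv, inv_stepsize]
            have := add_one_rpow_le_two_mul hT hα0'.le hα.le
            push_cast
            calc c⁻¹ * (((T : ℝ) + 1) ^ α / η₀) ≤ c⁻¹ * (2 * (T : ℝ) ^ α / η₀) := by gcongr
              _ = _ := by field_simp
          calc _ ≤ 2 * (2 * (T : ℝ) ^ α / (c * η₀)) := by linarith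
            _ = _ := by ring
      · rw [Finset.Ico_eq_empty (by omega), Finset.sum_empty]
        positivity
    have hsplit : ∑ t ∈ Finset.Icc 1 T, ‖stepError A η₀ α T t‖ ^ 2 ≤
        ∑ t ∈ Finset.Ico 1 t₀, ‖stepError A η₀ α T t‖ ^ 2 +
          ∑ t ∈ Finset.Ico t₀ (T + 1), ‖stepError A η₀ α T t‖ ^ 2 := by
      rw [← Finset.sum_union (Finset.Ico_disjoint_Ico_consecutive 1 t₀ (T + 1))]
      refine Finset.sum_le_sum_of_subset_of_nonneg (fun t ht => ?_) fun t _ _ => by positivity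
      rw [Finset.mem_Icc] at ht
      rw [Finset.mem_union, Finset.mem_Ico, Finset.mem_Ico]
      omega
    have hearly := Finset.sum_le_sum early
    rw [← hK₁] at hearly
    have hT1 : (1 : ℝ) ≤ (T : ℝ) ^ (2 * α - 1) := Real.one_le_rpow hT' hβ.le
    have h4 : K₁ + (1 + K 0) ≤ (K₁ + (1 + K 0)) * (T : ℝ) ^ (2 * α - 1) :=
      le_mul_of_one_le_right (by have := hK0 0; positivity) hT1
    have h5 : 2 * D ^ 2 * ((T : ℝ) ^ (2 * α - 1) / (2 * α - 1)) =
        2 * D ^ 2 / (2 * α - 1) * (T : ℝ) ^ (2 * α - 1) := by ring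
    have := hK0 0
    rw [add_assoc, add_mul]
    linarith
  · have h2 : ‖1 - stepSum A η₀ α T 0‖ ≤ 1 + K 0 :=
      (norm_sub_le _ _).trans (add_le_add norm_one_matrix_le (hK 0 T))
    have : 0 ≤ 2 * D ^ 2 / (2 * α - 1) := by positivity
    linarith

theorem dotProduct_mul_mul_transpose (Q : Matrix (Fin d) (Fin d) ℝ) (v : Fin d → ℝ) :
    v ⬝ᵥ (Q * Γ * Q.transpose).mulVec v =
      Q.transpose.mulVec v ⬝ᵥ Γ.mulVec (Q.transpose.mulVec v) := by
  rw [← Matrix.mulVec_mulVec, ← Matrix.mulVec_mulVec, Matrix.dotProduct_mulVec,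
    ← Matrix.mulVec_transpose]

/-- The relative error of the covariance form of `Λ̄_T` in terms of the errors `A Q_t - I`. -/
theorem abs_dotProduct_lambdaBar_sub_le {a b : ℝ} (hA : IsUnit A.det) (hΓ : Γ.IsHermitian)
    (ha0 : 0 < a) (ha : ∀ x, a * (x ⬝ᵥ x) ≤ x ⬝ᵥ Γ.mulVec x)
    (hb : ∀ x, x ⬝ᵥ Γ.mulVec x ≤ b * (x ⬝ᵥ x)) (hb0 : 0 ≤ b) {T : ℕ} (hT : 1 ≤ T)
    (hpos : ∀ x, 0 ≤ x ⬝ᵥ Γ.mulVec x) (v : Fin d → ℝ) :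
    |v ⬝ᵥ (lambdaBar A Γ η₀ α T).mulVec v - v ⬝ᵥ (A⁻¹ * Γ * A⁻¹.transpose).mulVec v| ≤
      (T : ℝ)⁻¹ * (b / a * ∑ t ∈ Finset.Icc 1 T, ‖stepError A η₀ α T t‖ ^ 2 +
        2 * ‖1 - stepSum A η₀ α T 0‖ * ‖Γ‖ / a) *
        (v ⬝ᵥ (A⁻¹ * Γ * A⁻¹.transpose).mulVec v) := by
  have hT' : (0 : ℝ) < T := by exact_mod_cast hT
  -- In this variable `Q_tᵀv = w + E_tᵀw`, and the form of `Λ⋆` at `v` is `wᵀΓw`.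
  set w := A⁻¹.transpose.mulVec v with hw
  have hv : v = A.transpose.mulVec w := by
    rw [hw, Matrix.mulVec_mulVec, ← Matrix.transpose_mul, Matrix.nonsing_inv_mul _ hA,
      Matrix.transpose_one, Matrix.one_mulVec]
  set y : ℕ → Fin d → ℝ := fun t => (stepError A η₀ α T t).transpose.mulVec w with hy
  have hQ : ∀ t, (matQ A η₀ α T t).transpose.mulVec v = w + y t := by
    intro t
    rw [hv, Matrix.mulVec_mulVec, ← Matrix.transpose_mul]
    have : A * matQ A η₀ α T t = 1 + stepError A η₀ α T t := by
      rw [stepError, matQ, add_sub_cancel, Matrix.mul_smul]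
      rfl
    rw [this, Matrix.transpose_add, Matrix.transpose_one, Matrix.add_mulVec, Matrix.one_mulVec]
  have hsymm : ∀ x z, x ⬝ᵥ Γ.mulVec z = z ⬝ᵥ Γ.mulVec x := by
    intro x z
    rw [Matrix.dotProduct_mulVec, ← Matrix.mulVec_transpose, dotProduct_comm]
    rw [show Γ.transpose = Γ from hΓ]
  have hexp : ∀ t, (w + y t) ⬝ᵥ Γ.mulVec (w + y t) =
      w ⬝ᵥ Γ.mulVec w + (y t ⬝ᵥ Γ.mulVec (y t) + 2 * (y t ⬝ᵥ Γ.mulVec w)) := by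
    intro t
    rw [Matrix.mulVec_add, add_dotProduct, dotProduct_add, dotProduct_add, hsymm w (y t)]
    ring
  have hbar : v ⬝ᵥ (lambdaBar A Γ η₀ α T).mulVec v = (T : ℝ)⁻¹ *
      ∑ t ∈ Finset.Icc 1 T, (w + y t) ⬝ᵥ Γ.mulVec (w + y t) := by
    rw [lambdaBar, Matrix.smul_mulVec, dotProduct_smul, Matrix.sum_mulVec, dotProduct_sum,
      smul_eq_mul]
    congr 1
    refine Finset.sum_congr rfl fun t _ => ?_
    rw [dotProduct_mul_mul_transpose, hQ]
  rw [hbar, dotProduct_mul_mul_transpose, ← hw]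
  simp only [hexp]
  rw [Finset.sum_add_distrib, Finset.sum_const, Nat.card_Icc, Nat.add_sub_cancel, nsmul_eq_mul,
    mul_add, inv_mul_cancel_left₀ hT'.ne', add_sub_cancel_left, abs_mul, abs_of_pos (inv_pos.2 hT'),
    mul_assoc, Finset.sum_add_distrib, ← Finset.mul_sum]
  refine mul_le_mul_of_nonneg_left ?_ (inv_pos.2 hT').le
  refine (abs_add_le _ _).trans ?_
  rw [add_mul]
  have haw := ha w
  have hn : w ⬝ᵥ w ≤ (w ⬝ᵥ Γ.mulVec w) / a := by rw [le_div_iff₀' ha0]; exact haw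
  refine add_le_add ?_ ?_
  · rw [abs_of_nonneg (Finset.sum_nonneg fun t _ => hpos _)]
    calc _ ≤ ∑ t ∈ Finset.Icc 1 T, b * (‖stepError A η₀ α T t‖ ^ 2 * (w ⬝ᵥ w)) := by
          refine Finset.sum_le_sum fun t _ => (hb _).trans ?_
          refine mul_le_mul_of_nonneg_left ?_ hb0
          rw [← norm_toLp_sq, ← norm_toLp_sq, ← mul_pow, ← norm_transpose_eq (stepError A η₀ α T t)]
          gcongr
          exact norm_toLp_mulVec_le _ _
      _ = b * (∑ t ∈ Finset.Icc 1 T, ‖stepError A η₀ α T t‖ ^ 2) * (w ⬝ᵥ w) := by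
          rw [← Finset.mul_sum, ← Finset.sum_mul, mul_assoc]
      _ ≤ b * (∑ t ∈ Finset.Icc 1 T, ‖stepError A η₀ α T t‖ ^ 2) * ((w ⬝ᵥ Γ.mulVec w) / a) := by
          gcongr
      _ = _ := by ring
  -- The cross term is summed before taking norms, so that the errors telescope.
  · have hsum : ∑ t ∈ Finset.Icc 1 T, y t ⬝ᵥ Γ.mulVec w =
        (1 - stepSum A η₀ α T 0).transpose.mulVec w ⬝ᵥ Γ.mulVec w := by
      rw [← sum_dotProduct, ← sum_stepError, Matrix.transpose_sum, Matrix.sum_mulVec]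
    rw [hsum, abs_mul, abs_two]
    calc _ ≤ 2 * ((‖1 - stepSum A η₀ α T 0‖ * ‖WithLp.toLp 2 w‖) * (‖Γ‖ * ‖WithLp.toLp 2 w‖)) := by
          refine mul_le_mul_of_nonneg_left ((abs_dotProduct_le _ _).trans ?_) zero_le_two
          rw [← norm_transpose_eq (1 - stepSum A η₀ α T 0)]
          gcongr
          · exact norm_toLp_mulVec_le _ _
          · exact norm_toLp_mulVec_le _ _
      _ = 2 * ‖1 - stepSum A η₀ α T 0‖ * ‖Γ‖ * (w ⬝ᵥ w) := by rw [← norm_toLp_sq]; ring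
      _ ≤ 2 * ‖1 - stepSum A η₀ α T 0‖ * ‖Γ‖ * ((w ⬝ᵥ Γ.mulVec w) / a) := by gcongr
      _ = _ := by ring

end ErrorBound

/-! ### From the covariance form to total variation -/

/-- `Λ̄_T` is positive definite because `Q_T = η_T I`. -/
theorem posDef_lambdaBar {d : ℕ} (A : Matrix (Fin d) (Fin d) ℝ) {Γ : Matrix (Fin d) (Fin d) ℝ}
    (hΓ : Γ.PosDef) {η₀ : ℝ} (hη : 0 < η₀) (α : ℝ) {T : ℕ} (hT : 1 ≤ T) :
    (lambdaBar A Γ η₀ α T).PosDef := by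
  have hT' : (0 : ℝ) < T := by exact_mod_cast hT
  have hs := stepsize_pos (α := α) hη hT
  refine Matrix.PosDef.smul ?_ (inv_pos.2 hT')
  rw [← Finset.add_sum_erase _ _ (Finset.mem_Icc.2 ⟨hT, le_rfl⟩)]
  refine Matrix.PosDef.add_posSemidef ?_ (Matrix.posSemidef_sum _ fun t _ =>
    hΓ.posSemidef.mul_mul_conjTranspose_same _)
  have hQ : matQ A η₀ α T T = stepsize η₀ α T • 1 := by
    rw [matQ, Finset.Icc_self, Finset.sum_singleton, stepProd_self]
  rw [hQ]
  simp only [Matrix.transpose_smul, Matrix.transpose_one, Matrix.smul_mul, Matrix.mul_smul,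
    Matrix.one_mul, Matrix.mul_one]
  exact (hΓ.smul hs).smul hs

section Comparison

variable {d : ℕ} {A Γ : Matrix (Fin d) (Fin d) ℝ} {η₀ α : ℝ}

-- The cross term is of order `1/T`, which `T^(2α-2)` dominates since `α > 1/2`.
open scoped Matrix.Norms.L2Operator in
theorem exists_abs_dotProduct_lambdaBar_sub_le {a b c : ℝ} (hc : 0 < c)
    (hA : ∀ x, c * (x ⬝ᵥ x) ≤ x ⬝ᵥ A.mulVec x) (hAu : IsUnit A.det) (hΓ : Γ.PosSemidef)
    (ha0 : 0 < a) (ha : ∀ x, a * (x ⬝ᵥ x) ≤ x ⬝ᵥ Γ.mulVec x)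
    (hb : ∀ x, x ⬝ᵥ Γ.mulVec x ≤ b * (x ⬝ᵥ x)) (hb0 : 0 ≤ b)
    (hη : 0 < η₀) (hα0 : 1 / 2 < α) (hα : α < 1) :
    ∃ K, 0 ≤ K ∧ ∀ T : ℕ, 1 ≤ T → ∀ v,
      |v ⬝ᵥ (lambdaBar A Γ η₀ α T).mulVec v - v ⬝ᵥ (A⁻¹ * Γ * A⁻¹.transpose).mulVec v| ≤
        (4 * (b / a) / (c * η₀) * (T : ℝ) ^ (α - 1) + K * (T : ℝ) ^ (2 * α - 2)) *
          (v ⬝ᵥ (A⁻¹ * Γ * A⁻¹.transpose).mulVec v) := by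
  obtain ⟨K, hK0, hK⟩ := exists_sum_norm_stepError_sq_le hc hA hη hα0 hα
  refine ⟨b / a * K + 2 * K * ‖Γ‖ / a, by positivity, fun T hT v => ?_⟩
  obtain ⟨h1, h2⟩ := hK T hT
  have hT' : (1 : ℝ) ≤ T := by exact_mod_cast hT
  have hT0 : (0 : ℝ) < T := by positivity
  have hpos : ∀ x, 0 ≤ x ⬝ᵥ Γ.mulVec x := fun x => hΓ.dotProduct_mulVec_nonneg x
  refine (abs_dotProduct_lambdaBar_sub_le hAu hΓ.isHermitian ha0 ha hb hb0 hT hpos v).trans ?_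
  refine mul_le_mul_of_nonneg_right ?_ ?_
  · have hT1 : (1 : ℝ) ≤ (T : ℝ) ^ (2 * α - 1) := Real.one_le_rpow hT' (by linarith)
    have e1 : (T : ℝ) ^ (α - 1) = (T : ℝ)⁻¹ * (T : ℝ) ^ α := by
      rw [Real.rpow_sub_one hT0.ne', div_eq_inv_mul]
    have e2 : (T : ℝ) ^ (2 * α - 2) = (T : ℝ)⁻¹ * (T : ℝ) ^ (2 * α - 1) := by
      rw [show 2 * α - 2 = 2 * α - 1 - 1 by ring, Real.rpow_sub_one hT0.ne', div_eq_inv_mul]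
    have h3 : 2 * ‖1 - stepSum A η₀ α T 0‖ * ‖Γ‖ / a ≤
        2 * K * ‖Γ‖ / a * (T : ℝ) ^ (2 * α - 1) := by
      refine le_trans ?_ (le_mul_of_one_le_right (by positivity) hT1)
      gcongr
    calc _ ≤ (T : ℝ)⁻¹ * (b / a * (4 / (c * η₀) * (T : ℝ) ^ α + K * (T : ℝ) ^ (2 * α - 1)) +
          2 * K * ‖Γ‖ / a * (T : ℝ) ^ (2 * α - 1)) := by gcongr
      _ = _ := by rw [e1, e2]; ring
  · rw [dotProduct_mul_mul_transpose]
    exact hpos _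

/-- When `ε` is too large for the Gaussian comparison, `1 ≤ (4 + d)ε²`. The trivial bound by `1` is
then of order `T^(2α-2)`, so the leading constant is unaffected. -/
theorem exists_tvDistance_lambdaBar_le {a b c : ℝ} (hc : 0 < c)
    (hA : ∀ x, c * (x ⬝ᵥ x) ≤ x ⬝ᵥ A.mulVec x) (hAu : IsUnit A.det) (hΓ : Γ.PosDef)
    (ha0 : 0 < a) (ha : ∀ x, a * (x ⬝ᵥ x) ≤ x ⬝ᵥ Γ.mulVec x)
    (hb : ∀ x, x ⬝ᵥ Γ.mulVec x ≤ b * (x ⬝ᵥ x)) (hb0 : 0 ≤ b)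
    (hη : 0 < η₀) (hα0 : 1 / 2 < α) (hα : α < 1) :
    ∃ K, ∀ T : ℕ, 1 ≤ T →
      tvDistance (centeredGaussian (lambdaBar A Γ η₀ α T))
          (centeredGaussian (A⁻¹ * Γ * A⁻¹.transpose)) ≤
        Real.sqrt (2 * d) * (4 * (b / a) / (c * η₀)) * (T : ℝ) ^ (α - 1) +
          K * (T : ℝ) ^ (2 * α - 2) := by
  obtain ⟨K, hK0, hK⟩ :=
    exists_abs_dotProduct_lambdaBar_sub_le hc hA hAu hΓ.posSemidef ha0 ha hb hb0 hη hα0 hα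
  set m := 4 * (b / a) / (c * η₀) with hm
  have hm0 : 0 ≤ m := by positivity
  have hΛ : (A⁻¹ * Γ * A⁻¹.transpose).PosDef := by
    refine hΓ.mul_mul_conjTranspose_same ?_
    exact Matrix.vecMul_injective_of_isUnit ((Matrix.isUnit_iff_isUnit_det _).2
      (Matrix.isUnit_nonsing_inv_det _ hAu))
  refine ⟨Real.sqrt (2 * d) * K + (4 + d) * (m + K) ^ 2, fun T hT => ?_⟩
  have hT' : (1 : ℝ) ≤ T := by exact_mod_cast hT
  set x := (T : ℝ) ^ (α - 1) with hx
  have hx0 : 0 ≤ x := by positivity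
  have hx1 : x ≤ 1 := Real.rpow_le_one_of_one_le_of_nonpos hT' (by linarith)
  have hx2 : (T : ℝ) ^ (2 * α - 2) = x ^ 2 := by
    rw [hx, ← Real.rpow_mul_natCast (by positivity)]
    congr 1
    push_cast
    ring
  have hKT := hK T hT
  rw [hx2, ← hx] at *
  set ε := m * x + K * x ^ 2 with hε
  have hε0 : 0 ≤ ε := by positivity
  have hεle : ε ≤ (m + K) * x := by
    rw [hε, add_mul]
    gcongr
    nlinarith
  have hsq : ε ^ 2 ≤ (m + K) ^ 2 * x ^ 2 := by
    rw [← mul_pow]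
    gcongr
  have hd0 : (0 : ℝ) ≤ d := d.cast_nonneg
  by_cases hsmall : ε ≤ 1 / 2 ∧ d * ε ^ 2 ≤ 1
  · have h1 := tvDistance_centeredGaussian_le hΛ
      (posDef_lambdaBar A hΓ hη α hT).posSemidef hε0 hsmall.1 hsmall.2 hKT
    have h2 : 0 ≤ (4 + d) * (m + K) ^ 2 * x ^ 2 := by positivity
    rw [hε] at h1
    linarith
  · have h1 := tvDistance_le_one (centeredGaussian (lambdaBar A Γ η₀ α T))
      (centeredGaussian (A⁻¹ * Γ * A⁻¹.transpose))
    have h2 : 1 ≤ (4 + d) * ε ^ 2 := by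
      rcases not_and_or.1 hsmall with h | h
      · nlinarith [mul_nonneg hd0 (sq_nonneg ε)]
      · nlinarith [sq_nonneg ε]
    have h3 : (4 + d) * ε ^ 2 ≤ (4 + d) * ((m + K) ^ 2 * x ^ 2) := by gcongr
    have h4 : 0 ≤ Real.sqrt (2 * d) * m * x + Real.sqrt (2 * d) * K * x ^ 2 := by positivity
    linarith

end Comparison

/-! ### Rayleigh bounds by extreme eigenvalues -/

section Eigenvalues

variable {d : ℕ} {M : Matrix (Fin d) (Fin d) ℝ}

theorem dotProduct_mulVec_eq_sum_eigenvalues (hM : M.IsHermitian) (x : Fin d → ℝ) :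
    ∃ y : Fin d → ℝ, x ⬝ᵥ M.mulVec x = ∑ i, hM.eigenvalues i * y i ^ 2 ∧
      x ⬝ᵥ x = ∑ i, y i ^ 2 := by
  set U : Matrix (Fin d) (Fin d) ℝ := hM.eigenvectorUnitary.1
  have hUU : U * U.transpose = 1 := Unitary.coe_mul_star_self hM.eigenvectorUnitary
  have hsp : M = U * Matrix.diagonal hM.eigenvalues * U.transpose := hM.spectral_theorem
  refine ⟨U.transpose.mulVec x, ?_, ?_⟩
  · rw [← dotProduct_mul_diagonal_mul_transpose, ← hsp]
  · have := dotProduct_mul_diagonal_mul_transpose U 1 x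
    simpa [hUU] using this

theorem lambdaMin_mul_le (hM : M.IsHermitian) (x : Fin d → ℝ) :
    lambdaMin M * (x ⬝ᵥ x) ≤ x ⬝ᵥ M.mulVec x := by
  obtain ⟨y, h1, h2⟩ := dotProduct_mulVec_eq_sum_eigenvalues hM x
  rw [h1, h2, Finset.mul_sum]
  gcongr with i
  exact csInf_le M.finite_real_spectrum.bddBelow (hM.eigenvalues_mem_spectrum_real i)

theorem le_lambdaMax_mul (hM : M.IsHermitian) (x : Fin d → ℝ) :
    x ⬝ᵥ M.mulVec x ≤ lambdaMax M * (x ⬝ᵥ x) := by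
  obtain ⟨y, h1, h2⟩ := dotProduct_mulVec_eq_sum_eigenvalues hM x
  rw [h1, h2, Finset.mul_sum]
  gcongr with i
  exact le_csSup M.finite_real_spectrum.bddAbove (hM.eigenvalues_mem_spectrum_real i)

theorem lambdaMin_pos [NeZero d] (hM : M.PosDef) : 0 < lambdaMin M := by
  have hne : (spectrum ℝ M).Nonempty := ⟨_, hM.isHermitian.eigenvalues_mem_spectrum_real 0⟩
  have hmem : lambdaMin M ∈ spectrum ℝ M := hne.csInf_mem M.finite_real_spectrum
  rw [hM.isHermitian.spectrum_real_eq_range_eigenvalues] at hmem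
  obtain ⟨i, hi⟩ := hmem
  rw [← hi]
  exact hM.eigenvalues_pos i

theorem lambdaMin_le_lambdaMax [NeZero d] (hM : M.IsHermitian) : lambdaMin M ≤ lambdaMax M :=
  csInf_le_csSup ⟨_, hM.eigenvalues_mem_spectrum_real 0⟩ M.finite_real_spectrum.bddBelow
    M.finite_real_spectrum.bddAbove

end Eigenvalues

/-! ### Coercivity of the mean TD matrix -/

namespace MDP

variable {S Act : Type*} [Fintype S] [Fintype Act] {d : ℕ}

theorem kernel_nonneg (M : MDP S Act) {π : S → Act → ℝ} (hπ : IsPolicy π) (s s' : S) :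
    0 ≤ M.kernel π s s' :=
  Finset.sum_nonneg fun a _ => mul_nonneg ((hπ s).1 a) ((M.P_mem s a).1 s')

theorem sum_kernel (M : MDP S Act) {π : S → Act → ℝ} (hπ : IsPolicy π) (s : S) :
    ∑ s', M.kernel π s s' = 1 := by
  simp only [kernel]
  rw [Finset.sum_comm]
  simp only [← Finset.mul_sum, (M.P_mem s _).2, mul_one]
  exact (hπ s).2

theorem dotProduct_featureCov_mulVec (μ : S → ℝ) (φ : S → EuclideanSpace ℝ (Fin d))
    (x : Fin d → ℝ) :
    x ⬝ᵥ (featureCov μ φ).mulVec x = ∑ s, μ s * (x ⬝ᵥ (φ s).ofLp) ^ 2 := by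
  rw [featureCov, Matrix.sum_mulVec, dotProduct_sum]
  refine Finset.sum_congr rfl fun s _ => ?_
  rw [Matrix.smul_mulVec, dotProduct_smul, Matrix.vecMulVec_mulVec, smul_eq_mul]
  simp only [op_smul_eq_smul, dotProduct_smul, smul_eq_mul]
  rw [dotProduct_comm (φ s).ofLp x]
  ring

/-- The coercivity of `A`: its symmetric part dominates `(1 - γ) Σ`. -/
theorem featureCov_le_meanA (M : MDP S Act) {π : S → Act → ℝ} {μ : S → ℝ} (hπ : IsPolicy π)
    (hμ : M.IsStationary π μ) (φ : S → EuclideanSpace ℝ (Fin d)) (x : Fin d → ℝ) :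
    (1 - M.γ) * (x ⬝ᵥ (featureCov μ φ).mulVec x) ≤ x ⬝ᵥ (M.meanA π μ φ).mulVec x := by
  set f : S → ℝ := fun s => x ⬝ᵥ (φ s).ofLp with hf
  have hAx : x ⬝ᵥ (M.meanA π μ φ).mulVec x =
      ∑ s, ∑ s', μ s * M.kernel π s s' * (f s * (f s - M.γ * f s')) := by
    rw [meanA, Matrix.sum_mulVec, dotProduct_sum]
    refine Finset.sum_congr rfl fun s _ => ?_
    rw [Matrix.sum_mulVec, dotProduct_sum]
    refine Finset.sum_congr rfl fun s' _ => ?_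
    rw [Matrix.smul_mulVec, dotProduct_smul, sampleA, Matrix.vecMulVec_mulVec, smul_eq_mul]
    simp only [op_smul_eq_smul, dotProduct_smul, smul_eq_mul, WithLp.ofLp_sub, WithLp.ofLp_smul, hf,
      sub_dotProduct, smul_dotProduct]
    rw [dotProduct_comm (φ s).ofLp x, dotProduct_comm (φ s').ofLp x]
    ring
  have h1 : ∑ s, ∑ s', μ s * M.kernel π s s' * f s ^ 2 = ∑ s, μ s * f s ^ 2 := by
    refine Finset.sum_congr rfl fun s _ => ?_
    rw [← Finset.sum_mul, ← Finset.mul_sum, M.sum_kernel hπ, mul_one]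
  -- By stationarity `f(s')²` has the same mean as `f(s)²`, so Young's inequality for `f(s)f(s')`
  -- loses only the factor `γ`.
  have h2 : ∑ s, ∑ s', μ s * M.kernel π s s' * f s' ^ 2 = ∑ s, μ s * f s ^ 2 := by
    rw [Finset.sum_comm]
    refine Finset.sum_congr rfl fun s _ => ?_
    rw [← Finset.sum_mul, hμ.2]
  rw [hAx, dotProduct_featureCov_mulVec]
  calc (1 - M.γ) * ∑ s, μ s * f s ^ 2
      = (1 - M.γ / 2) * ∑ s, ∑ s', μ s * M.kernel π s s' * f s ^ 2 -
          M.γ / 2 * ∑ s, ∑ s', μ s * M.kernel π s s' * f s' ^ 2 := by rw [h1, h2]; ring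
    _ = ∑ s, ∑ s', μ s * M.kernel π s s' * ((1 - M.γ / 2) * f s ^ 2 - M.γ / 2 * f s' ^ 2) := by
        simp only [Finset.mul_sum, ← Finset.sum_sub_distrib]
        refine Finset.sum_congr rfl fun s _ => Finset.sum_congr rfl fun s' _ => ?_
        ring
    _ ≤ _ := by
        refine Finset.sum_le_sum fun s _ => Finset.sum_le_sum fun s' _ => ?_
        refine mul_le_mul_of_nonneg_left ?_ (mul_nonneg (hμ.1.1 s) (M.kernel_nonneg hπ s s'))
        nlinarith [mul_nonneg M.γ_nonneg (sq_nonneg (f s - f s'))]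

end MDP

theorem isHermitian_featureCov {S : Type*} [Fintype S] {d : ℕ} (μ : S → ℝ)
    (φ : S → EuclideanSpace ℝ (Fin d)) : (featureCov μ φ).IsHermitian := by
  rw [Matrix.IsHermitian, Matrix.conjTranspose_eq_transpose_of_trivial, featureCov,
    Matrix.transpose_sum]
  refine Finset.sum_congr rfl fun s _ => ?_
  rw [Matrix.transpose_smul, Matrix.transpose_vecMulVec]

theorem isUnit_det_of_coercive {d : ℕ} {A : Matrix (Fin d) (Fin d) ℝ} {c : ℝ} (hc : 0 < c)
    (hA : ∀ x, c * (x ⬝ᵥ x) ≤ x ⬝ᵥ A.mulVec x) : IsUnit A.det := by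
  rw [isUnit_iff_ne_zero]
  intro h
  obtain ⟨x, hx, hAx⟩ := Matrix.exists_mulVec_eq_zero_iff.2 h
  have h1 := hA x
  rw [hAx, dotProduct_zero] at h1
  have h2 : 0 < x ⬝ᵥ x := by simpa using Matrix.dotProduct_star_self_pos_iff.2 hx
  have := mul_pos hc h2
  linarith

/-! ### The main theorem -/

/-- Gaussian comparison between the finite-sample covariance `Λ̄_T` and the asymptotic covariance
`Λ⋆` of averaged TD learning. The multiplicative constant depends only on the condition number
of `Γ`; the constant `C'` is independent of `T`. -/
theorem mainTheorem4 :
    ∃ C : ℝ → ℝ, (∀ κ, 0 < C κ) ∧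
      ∀ {S Act : Type*} [Fintype S] [Fintype Act] (M : MDP S Act) (π : S → Act → ℝ) (μ : S → ℝ)
        (d : ℕ) (φ : S → EuclideanSpace ℝ (Fin d)) (α η₀ : ℝ),
        IsPolicy π → M.IsUniqueStationary π μ → (∀ s, ‖φ s‖ ≤ 1) →
        0 < lambdaMin (featureCov μ φ) → (M.noiseCov π μ φ).PosDef →
        1 / 2 < α → α < 1 → 0 < η₀ → η₀ < 1 / 2 →
        ∃ C' : ℝ, ∀ T : ℕ, 1 ≤ T →
          convexDistance
              (centeredGaussian (lambdaBar (M.meanA π μ φ) (M.noiseCov π μ φ) η₀ α T))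
              (centeredGaussian (M.lambdaStar π μ φ)) ≤
            tvDistance
              (centeredGaussian (lambdaBar (M.meanA π μ φ) (M.noiseCov π μ φ) η₀ α T))
              (centeredGaussian (M.lambdaStar π μ φ)) ∧
          tvDistance
              (centeredGaussian (lambdaBar (M.meanA π μ φ) (M.noiseCov π μ φ) η₀ α T))
              (centeredGaussian (M.lambdaStar π μ φ)) ≤
            C (condNumber (M.noiseCov π μ φ)) *
                (Real.sqrt (d * condNumber (M.noiseCov π μ φ)) /
                  ((1 - M.γ) * lambdaMin (featureCov μ φ) * η₀)) * (T : ℝ) ^ (α - 1) +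
              C' * (T : ℝ) ^ (2 * α - 2) := by

  -- From `√(2d)·4κ = 4√2·√κ·√(dκ)` and `√2 ≤ 2`; the `+ 1` keeps the value positive for `κ ≤ 0`.
  refine ⟨fun κ => 8 * Real.sqrt κ + 1, fun κ => by positivity, ?_⟩
  intro S Act _ _ M π μ d φ α η₀ hπ hμ _ hcov hΓ hα0 hα hη _
  -- For `d = 0` the spectrum is empty and `sInf ∅ = 0`, against `0 < lambdaMin`.
  have : NeZero d := ⟨by
    rintro rfl
    simp [lambdaMin, spectrum.of_subsingleton] at hcov⟩
  have hγ : 0 < 1 - M.γ := by linarith [M.γ_lt_one]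
  set Γ := M.noiseCov π μ φ
  set A := M.meanA π μ φ with hAdef
  set c := (1 - M.γ) * lambdaMin (featureCov μ φ) with hcdef
  have hc : 0 < c := mul_pos hγ hcov
  have hA : ∀ x, c * (x ⬝ᵥ x) ≤ x ⬝ᵥ A.mulVec x := fun x => by
    refine le_trans ?_ (M.featureCov_le_meanA hπ hμ.1 φ x)
    rw [hcdef, mul_assoc]
    exact mul_le_mul_of_nonneg_left (lambdaMin_mul_le (isHermitian_featureCov μ φ) x) hγ.le
  have hAu := isUnit_det_of_coercive hc hA
  have ha0 := lambdaMin_pos hΓ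
  have hb0 : 0 ≤ lambdaMax Γ := ha0.le.trans (lambdaMin_le_lambdaMax hΓ.isHermitian)
  obtain ⟨K, hK⟩ := exists_tvDistance_lambdaBar_le hc hA hAu hΓ ha0
    (lambdaMin_mul_le hΓ.isHermitian) (le_lambdaMax_mul hΓ.isHermitian) hb0 hη hα0 hα
  have hΛ : (M.lambdaStar π μ φ).PosDef := by
    refine hΓ.mul_mul_conjTranspose_same ?_
    exact Matrix.vecMul_injective_of_isUnit ((Matrix.isUnit_iff_isUnit_det _).2
      (Matrix.isUnit_nonsing_inv_det _ hAu))
  refine ⟨K, fun T hT => ⟨convexDistance_le_tvDistance hΛ (posDef_lambdaBar A hΓ hη α hT), ?_⟩⟩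
  refine (hK T hT).trans ?_
  refine add_le_add (mul_le_mul_of_nonneg_right ?_ (by positivity)) le_rfl
  change Real.sqrt (2 * d) * (4 * condNumber Γ / (c * η₀)) ≤ _
  have hκ : 0 ≤ condNumber Γ := div_nonneg hb0 ha0.le
  set κ := condNumber Γ
  rw [Real.sqrt_mul zero_le_two, Real.sqrt_mul (Nat.cast_nonneg d)]
  have h2 : Real.sqrt 2 ≤ 2 := Real.sqrt_le_iff.2 (by norm_num)
  have e : Real.sqrt 2 * Real.sqrt d * (4 * κ / (c * η₀)) =
      4 * Real.sqrt 2 * Real.sqrt κ * (Real.sqrt d * Real.sqrt κ / (c * η₀)) := by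
    conv_lhs => rw [← Real.mul_self_sqrt hκ]
    ring
  rw [e]
  gcongr
  have := Real.sqrt_nonneg κ
  nlinarith
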